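/- **Setting.** A site is a triple $(a,b,c)$ ($b$ baskets, $c$ balls, $a=b-c+1$ free places), and the vacuum is $V=(1,0,0)$. A state is a sequence of sites $(S_i)_{i\in\mathbb Z}$ with $S_i=V$ for $|i|\gg0$. For $\ell\in\{2,3,\dots\}\cup\{\infty\}$ the time evolution $T_\ell$ is defined by a carrier which starts at the far left as $u_\ell=(\ell,0,0)$ and passes all sites from left to right. When a carrier $(a,b,c)$ passes a site $(d,e,f)$, put $P=\min(a+b,a+c,b+f)$, $Q=\min(a+e,d+f,e+f)$, $R=\min(e+c,d+c,d+b)$. The site becomes $(d+P-R,\;e+P-Q,\;f+R-Q)$ and the carrier becomes $(a-P+R,\;b-P+Q,\;c-R+Q)$. Let $F=(0,0,1)$, and for $a\ge1$ let $B_a=(a+1,a,0)$ and $U_a=(a,a,1)$. Let $F_k=F\cdots F$ ($k$ letters, speed $k$) and $B_{a_1,\dots,a_r}=B_{a_1}\cdots B_{a_r}$. A *basic slow soliton* (speed $1$) is a nonempty string of letters $F,B_a,U_a$ without consecutive letters $FF$ or $FU_a$. A *disjoint union* $A_1\sqcup\dots\sqcup A_n$ is a state consisting of the strings $A_1,\dots,A_n$,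 from left to right, with only vacuum sites elsewhere and at least (speed of $A_i$) vacuum sites between $A_i$ and $A_{i+1}$. **Proposition.** Let $A$ be a basic slow soliton (for instance a composite one, i.e. one that is neither $F$ nor of the form $B_{a_1,\dots,a_r}$). Then $A$ can be cut in exactly one way into consecutive chunks of the kinds listed on the left below, where an initial $V$ denotes the vacuum site in front of $A$, each chunk is followed by a letter $B$ or by the vacuum behind $A$, and no two consecutive chunks are both of the last kind. To each chunk assign a number of solitons $F$ and a (possibly empty) string of letters $B$: $$\begin{aligned} B_aU_{b_1}\cdots U_{b_r}\ (r\ge1)&\longmapsto F^{\sqcup r}\sqcup B_{a+b_1+\cdots+b_r}\\ B_aU_{b_1}\cdots U_{b_r}F\ (r\ge0)&\longmapsto F^{\sqcup (r+1)}\sqcup B_{a+b_1+\cdots+b_r}\\ VU_{b_1}\cdots U_{b_r}\ (r\ge1)&\longmapsto F^{\sqcup r}\sqcup B_{b_1+\cdots+b_r}\\ VU_{b_1}\cdots U_{b_r}F\ (r\ge1)&\longmapsto F^{\sqcup (r+1)}\sqcup B_{b_1+\cdots+b_r}\\ VF&\longmapsto F\\ B_{a_1}\cdots B_{a_r}\ (r\ge1)&\longmapsto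 B_{a_1,\dots,a_r} \end{aligned}$$ Let $n$ be the total number of these $F$, and let $B_{c_1,\dots,c_s}$ be the concatenation, in the order of the chunks, of the strings of letters $B$ (nothing if $s=0$). Then there is $M_0$, depending only on $A$, such that for every $\ell\in\{2,3,\dots\}\cup\{\infty\}$, all $M\ge M_0$, all $k_1,\dots,k_M\ge2$ and every state $S$ of the form $F_{k_1}\sqcup\dots\sqcup F_{k_M}\sqcup A$, the following holds for all sufficiently large $N$: $$T_\ell^N(S)=F^{\sqcup n}\sqcup B_{c_1,\dots,c_s}\sqcup F_{k'_1}\sqcup\dots\sqcup F_{k'_M}$$ for some rearrangement $k'_1,\dots,k'_M$ of $k_1,\dots,k_M$ (which may depend on $N$). That is, the chunks of $A$ decompose into pure solitons as listed. -/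

import Mathlib

namespace BoxBasketBall

/-- The content of a site: `a` free places, `b` baskets, `c` balls.  A site with one box
satisfies `a = b - c + 1`. -/
@[ext] structure Site where
  a : ℤ
  b : ℤ
  c : ℤ

/-- A carrier: `a` (possibly infinite) free places, `b` baskets, `c` balls. -/
@[ext] structure Carrier where
  a : WithTop ℤ
  b : ℤ
  c : ℤ

/-- The vacuum site `(1, 0, 0)`. -/
def V : Site := ⟨1, 0, 0⟩

/-- A state: one site for each integer. -/
abbrev State := ℤ → Site

/-! Interaction of a carrier `C = (a, b, c)` with a site `S = (d, e, f)`: the tropicalization of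
the whurl relation, through the three minima `P, Q, R` below.  The minima `P` and `Q` are
finite even if `a = ∞`. -/

/-- `P = min (a + b, a + c, b + f)`. -/
def minP (C : Carrier) (S : Site) : ℤ :=
  (min (min (C.a + (C.b : WithTop ℤ)) (C.a + (C.c : WithTop ℤ)))
    ((C.b + S.c : ℤ) : WithTop ℤ)).untopD 0

/-- `Q = min (a + e, d + f, e + f)`. -/
def minQ (C : Carrier) (S : Site) : ℤ :=
  (min (C.a + (S.b : WithTop ℤ))
    ((min (S.a + S.c) (S.b + S.c) : ℤ) : WithTop ℤ)).untopD 0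

/-- `R = min (e + c, d + c, d + b)`. -/
def minR (C : Carrier) (S : Site) : ℤ :=
  min (min (S.b + C.c) (S.a + C.c)) (S.a + C.b)

/-- The new content of the site after the carrier has passed. -/
def newSite (C : Carrier) (S : Site) : Site where
  a := S.a + minP C S - minR C S
  b := S.b + minP C S - minQ C S
  c := S.c + minR C S - minQ C S

/-- The new content of the carrier after passing the site. -/
def newCarrier (C : Carrier) (S : Site) : Carrier where
  a := C.a + ((minR C S - minP C S : ℤ) : WithTop ℤ)
  b := C.b - minP C S + minQ C S
  c := C.c - minR C S + minQ C S

/-- The initial carrier `u_ℓ = (ℓ, 0, 0)`, for `ℓ` a natural number or `∞`. -/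
def initialCarrier (ℓ : ℕ∞) : Carrier :=
  ⟨WithTop.map (fun n : ℕ => (n : ℤ)) ℓ, 0, 0⟩

/-- The carrier which starts as `u_ℓ` just before site `m`, after passing the `n` sites
`m, …, m + n - 1`. -/
def carrierFrom (ℓ : ℕ∞) (S : State) (m : ℤ) : ℕ → Carrier
  | 0 => initialCarrier ℓ
  | n + 1 => newCarrier (carrierFrom ℓ S m n) (S (m + n))

/-- The leftmost site which is not vacuum. -/
noncomputable def leftEnd (S : State) : ℤ := sInf {i | S i ≠ V}

/-- The carrier which comes from the far left as `u_ℓ`, as it arrives at site `i`.  It does not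
change while it passes vacuum sites, so it is `u_ℓ` up to the leftmost nonvacuum site. -/
noncomputable def carrierAt (ℓ : ℕ∞) (S : State) (i : ℤ) : Carrier :=
  carrierFrom ℓ S (leftEnd S) (i - leftEnd S).toNat

/-- The time evolution `T_ℓ`; for `ℓ = ⊤` it is that of the box-basket-ball system. -/
noncomputable def T (ℓ : ℕ∞) (S : State) : State := fun i => newSite (carrierAt ℓ S i) (S i)

/-- The letters `F`, `B_a`, `U_a`; the subscript is meant to be positive. -/
inductive Letter
  | F
  | B (a : ℕ)
  | U (a : ℕ)

/-- `F = (0, 0, 1)`, `B_a = (a + 1, a, 0)`, `U_a = (a, a, 1)`. -/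
def Letter.site : Letter → Site
  | .F => ⟨0, 0, 1⟩
  | .B a => ⟨a + 1, a, 0⟩
  | .U a => ⟨a, a, 1⟩

/-- The subscript of a letter is positive. -/
def Letter.Proper : Letter → Prop
  | .F => True
  | .B a => 1 ≤ a
  | .U a => 1 ≤ a

/-- `x y` is one of `F F` and `F U_a`. -/
def Letter.Forbidden : Letter → Letter → Prop
  | .F, .F => True
  | .F, .U _ => True
  | _, _ => False

/-- Basic slow solitons: the nonempty strings in `F, B_a, U_a` (`a ≥ 1`) which contain neither
`F F` nor `F U_a` as consecutive letters. -/
def IsSlowSoliton (w : List Letter) : Prop :=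
  w ≠ [] ∧ (∀ x ∈ w, x.Proper) ∧ w.IsChain (fun x y => ¬ x.Forbidden y)

/-- A basic soliton: `F_k`, or a slow soliton given by its letters. -/
inductive Soliton
  | fast (k : ℕ)
  | slow (w : List Letter)

/-- The sites which a soliton occupies. -/
def Soliton.sites : Soliton → List Site
  | .fast k => List.replicate k Letter.F.site
  | .slow w => w.map Letter.site

/-- The speed of a soliton. -/
def Soliton.speed : Soliton → ℕ
  | .fast k => k
  | .slow _ => 1

/-- The state with the sites `w` at positions `p, p + 1, …` and vacuum elsewhere. -/
def place (p : ℤ) (w : List Site) : State :=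
  fun i => if p ≤ i then w.getD (i - p).toNat V else V

/-- `S` is a disjoint union of the given solitons, in this order from left to right: each of them
is followed by at least as many vacuum sites as its speed. -/
def IsDisjointUnion (S : State) (L : List Soliton) : Prop :=
  ∃ (p : ℤ) (gaps : List ℕ), List.Forall₂ (fun A g => A.speed ≤ g) L gaps ∧
    S = place p (List.zipWith (fun A g => A.sites ++ List.replicate g V) L gaps).flatten

/-- The six kinds of chunks.  A list `bs` stands for `U_{b_1} … U_{b_r}`; an initial `V` is the
vacuum site in front of the soliton. -/
inductive Chunk
  /-- `B_a U_{b_1} … U_{b_r}` with `r ≥ 1`. -/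
  | BU (a b : ℕ) (bs : List ℕ)
  /-- `B_a U_{b_1} … U_{b_r} F` with `r ≥ 0`. -/
  | BUF (a : ℕ) (bs : List ℕ)
  /-- `V U_{b_1} … U_{b_r}` with `r ≥ 1`. -/
  | VU (b : ℕ) (bs : List ℕ)
  /-- `V U_{b_1} … U_{b_r} F` with `r ≥ 1`. -/
  | VUF (b : ℕ) (bs : List ℕ)
  /-- `V F`. -/
  | VF
  /-- `B_{a_1} … B_{a_r}` with `r ≥ 1`. -/
  | Bs (a : ℕ) (as : List ℕ)

/-- The letters of a chunk, without the initial vacuum site. -/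
def Chunk.letters : Chunk → List Letter
  | .BU a b bs => .B a :: (b :: bs).map .U
  | .BUF a bs => .B a :: bs.map .U ++ [.F]
  | .VU b bs => (b :: bs).map .U
  | .VUF b bs => (b :: bs).map .U ++ [.F]
  | .VF => [.F]
  | .Bs a as => (a :: as).map .B

/-- The chunk begins with a letter `B`. -/
def Chunk.StartsWithB : Chunk → Prop
  | .BU .. => True
  | .BUF .. => True
  | .Bs .. => True
  | _ => False

/-- The chunk is of the kind `B_{a_1} … B_{a_r}`. -/
def Chunk.IsRun : Chunk → Prop
  | .Bs .. => True
  | _ => False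

/-- `cs` is a cutting of the slow soliton `w` into chunks: each chunk but the last is followed
by a `B` (the last one is followed by vacuum), and the chunks of the kind `B_{a_1} … B_{a_r}` are
not cut further. -/
def IsCutting (cs : List Chunk) (w : List Letter) : Prop :=
  cs.flatMap Chunk.letters = w ∧
    cs.IsChain (fun c d => d.StartsWithB ∧ ¬ (c.IsRun ∧ d.IsRun))

/-- The number of solitons `F` into which a chunk decomposes. -/
def Chunk.numF : Chunk → ℕ
  | .BU _ b bs => (b :: bs).length
  | .BUF _ bs => bs.length + 1
  | .VU b bs => (b :: bs).length
  | .VUF b bs => (b :: bs).length + 1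
  | .VF => 1
  | .Bs _ _ => 0

/-- The subscripts of the soliton `B_{…}` into which a chunk decomposes besides the `F`
(none for `V F`, as `B_0 = V`). -/
def Chunk.subscripts : Chunk → List ℕ
  | .BU a b bs => [a + (b :: bs).sum]
  | .BUF a bs => [a + bs.sum]
  | .VU b bs => [(b :: bs).sum]
  | .VUF b bs => [(b :: bs).sum]
  | .VF => []
  | .Bs a as => a :: as

/-- The pure soliton `B_{a_1, …, a_r}` (nothing if there are no subscripts). -/
def pureB : List ℕ → List Soliton
  | [] => []
  | a :: as => [.slow ((a :: as).map .B)]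

/-- `F ⊔ … ⊔ F ⊔ B_{a_1, …, a_s}`, where every chunk contributes its `F`s and its subscripts, the
latter in the order of the chunks. -/
def decomposition (cs : List Chunk) : List Soliton :=
  List.replicate (cs.map Chunk.numF).sum (.slow [.F]) ++ pureB (cs.flatMap Chunk.subscripts)

end BoxBasketBall

open BoxBasketBall

/-! Idea. Write a site with $b$ baskets and $c$ balls as $c$ ones followed by $b+1-c$ zeros, so that
the box and its baskets become letters of a word. The word then evolves as in the ordinary box-ball
system with a carrier of capacity $\ell$ (for $\ell=\infty$, of any finite capacity exceeding the
number of balls). The baskets all move alike: the rank of a basket, its position minus the number of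
runs of ones begun so far, grows by exactly one in each step (`rank_stay`, `rank_move`,
`Enc.evolve`). A basket is never the first letter of a run of ones, and off these letters the rank
is injective; so the word and the set of ranks determine the state (`Enc.unique`). It remains to
follow the word and to compare with the encoding of the claimed state.

The word is given by the positions where its letter changes. Shortening all runs by one lowers the
capacity by one, up to a translation (`flow_stretch`). Runs that become empty are double entries,
and these do not move (`flow_ins`). Induction on the capacity yields the scattering of solitons
(`eventually_sw`). The balls of $A$ are isolated, so one shortening turns them into fixed double
entries, while the $M$ fast solitons survive it because $k\ge2$, and run past them. Undoing the
shortening, each fast soliton that has passed accounts for two changes fewer on the left: compared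
with unit speed, the balls fall back by $2M$ (`eventually_flow_sw_append`).

The position of a basket is its rank plus the number of runs on its left, so the baskets fall back
only by $M$, up to a bounded error. For large $M$ all balls end up to the left of all baskets, where
they are separate solitons $F$. The baskets keep their relative ranks. A box of $F$ or $U_b$ begins
a run of ones and leaves no gap between ranks, whereas a box of $B_a$ does; hence the baskets of
$U_{b_1},\dots,U_{b_r}$ merge with those of the preceding $B_a$, or with the vacuum in front of $A$
(`basketRuns_cutting`, `exists_runRanks_eq`). The cutting itself is forced letter by letter from the
right (`exists_consChunk_eq`). -/

namespace BoxBasketBall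

/-! ### Box-ball evolution on change positions -/

/-- The box-ball evolution of a word in `0, 1`, given by the increasing list of the positions where
the letter changes.  Here `x` is the number of letters which the carrier can still exchange in the
current run, and `y` the number which it will then be able to exchange in the next run. -/
def flow (x y : ℤ) : List ℤ → List ℤ
  | [] => []
  | [s] => [s + x]
  | s :: s' :: l => (s + min (s' - s) x) :: flow (y + min (s' - s) x) (x - min (s' - s) x) (s' :: l)

/-- Add `z, z + 1, z + 2, …` to the entries of a list. -/
def stretch (z : ℤ) : List ℤ → List ℤ
  | [] => []
  | s :: l => (s + z) :: stretch (z + 1) l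

/-- Insert `p` twice into a sorted list. -/
def ins (p : ℤ) : List ℤ → List ℤ
  | [] => [p, p]
  | s :: l => if s < p then s :: ins p l else p :: p :: s :: l

/-- The change positions of a word which starts at `p` and consists of blocks of `k` ones followed
by `g` zeros. -/
def sw (p : ℤ) : List (ℕ × ℕ) → List ℤ
  | [] => []
  | b :: l => p :: (p + b.1) :: sw (p + b.1 + b.2) l

/-- Each run of the stretched list is longer by one, so with one more unit available each exchange
is larger by one. The extra unit is passed on to the next run, where the same holds. -/
theorem flow_stretch (l : List ℤ) : ∀ x y z : ℤ,
    flow (x + 1) y (stretch z l) = stretch (z + 1) (flow x y l) := by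
  induction l with
  | nil => intros; rfl
  | cons s l ih =>
    intro x y z
    cases l with
    | nil => simp only [stretch, flow, List.cons.injEq, and_true]; ring
    | cons s' l =>
      have h : min (s' + (z + 1) - (s + z)) (x + 1) = min (s' - s) x + 1 := by omega
      have := ih (y + min (s' - s) x) (x - min (s' - s) x) (z + 1)
      simp only [stretch, flow, h] at this ⊢
      have e : y + (min (s' - s) x + 1) = y + min (s' - s) x + 1 := by ring
      have e' : x + 1 - (min (s' - s) x + 1) = x - min (s' - s) x := by ring
      rw [e, e', this, List.cons.injEq]
      exact ⟨by ring, rfl⟩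

theorem iterate_flow_stretch (x z : ℤ) (l : List ℤ) (N : ℕ) :
    (flow (x + 1) 0)^[N] (stretch z l) = stretch (z + N) ((flow x 0)^[N] l) := by
  induction N with
  | zero => simp
  | succ N ih =>
    rw [Function.iterate_succ_apply', Function.iterate_succ_apply', ih, flow_stretch]
    push_cast; rw [add_assoc]

theorem le_of_mem_flow (l : List ℤ) : ∀ x y s : ℤ, 0 ≤ x → 0 ≤ y →
    (s :: l).Pairwise (· ≤ ·) → ∀ t ∈ flow x y (s :: l), s ≤ t := by
  induction l with
  | nil => intro x y s hx _ _ t ht; simp [flow] at ht; omega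
  | cons s' l ih =>
    intro x y s hx hy hs t ht
    rw [List.pairwise_cons] at hs
    have h1 := hs.1 s' (by simp)
    simp only [flow, List.mem_cons] at ht
    rcases ht with rfl | ht
    · omega
    · have := ih _ _ s' (by omega) (by omega) hs.2 t ht
      omega

theorem pairwise_flow (l : List ℤ) : ∀ x y : ℤ, 0 ≤ x → 0 ≤ y →
    l.Pairwise (· ≤ ·) → (flow x y l).Pairwise (· ≤ ·) := by
  induction l with
  | nil => intros; simp [flow]
  | cons s l ih =>
    intro x y hx hy hs
    cases l with
    | nil => simp [flow]
    | cons s' l =>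
      rw [List.pairwise_cons] at hs
      have h1 := hs.1 s' (by simp)
      simp only [flow]
      rw [List.pairwise_cons]
      refine ⟨fun t ht => ?_, ih _ _ (by omega) (by omega) hs.2⟩
      have := le_of_mem_flow l _ _ s' (by omega) (by omega) hs.2 t ht
      omega

theorem ins_of_le {p : ℤ} {l : List ℤ} (h : ∀ t ∈ l, p ≤ t) : ins p l = p :: p :: l := by
  cases l with
  | nil => rfl
  | cons s l => simp [ins, not_lt.mpr (h s (by simp))]

theorem mem_ins {p t : ℤ} {l : List ℤ} : t ∈ ins p l ↔ t = p ∨ t ∈ l := by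
  induction l with
  | nil => simp [ins]
  | cons s l ih =>
    simp only [ins]
    split_ifs
    · simp only [List.mem_cons, ih]; tauto
    · simp only [List.mem_cons]; tauto

theorem pairwise_ins {p : ℤ} {l : List ℤ} (h : l.Pairwise (· ≤ ·)) :
    (ins p l).Pairwise (· ≤ ·) := by
  induction l with
  | nil => simp [ins]
  | cons s l ih =>
    rw [List.pairwise_cons] at h
    simp only [ins]
    split_ifs with hs
    · rw [List.pairwise_cons]
      refine ⟨fun t ht => ?_, ih h.2⟩
      rcases mem_ins.mp ht with rfl | ht
      · exact hs.le
      · exact h.1 t ht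
    · simp only [List.pairwise_cons, List.mem_cons]
      refine ⟨?_, ?_, h.1, h.2⟩
      · rintro t (rfl | rfl | ht)
        · rfl
        · omega
        · have := h.1 t ht; omega
      · rintro t (rfl | ht)
        · omega
        · have := h.1 t ht; omega

/-- A double entry is an empty run: nothing is exchanged there, and the exchanges in the two pieces
of the run that it divides add up to the old one. Whether the carrier is exhausted before `p` only
decides on which side of the pair the new change falls. -/
theorem flow_cons_ins (p : ℤ) (l : List ℤ) : ∀ x y s : ℤ, 0 ≤ x → 0 ≤ y → s < p →
    (s :: l).Pairwise (· ≤ ·) → flow x y (s :: ins p l) = ins p (flow x y (s :: l)) := by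
  induction l with
  | nil =>
    intro x y s hx hy hsp _
    simp only [ins, flow, sub_self]
    by_cases h : s + x < p
    · rw [if_pos h]; simp only [List.cons.injEq, and_true]; omega
    · rw [if_neg h]; simp only [List.cons.injEq, and_true]; omega
  | cons s' l ih =>
    intro x y s hx hy hsp hs
    rw [List.pairwise_cons] at hs
    have h1 := hs.1 s' (by simp)
    by_cases hp : s' < p
    · have := ih (y + min (s' - s) x) (x - min (s' - s) x) s' (by omega) (by omega) hp hs.2
      simp only [ins, if_pos hp, flow, this]
      rw [if_pos (by omega)]
    · have h3 : min (p - p) (y + min (p - s) x) = 0 := by omega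
      simp only [ins, if_neg hp, flow, h3, add_zero, sub_zero]
      have hd : min (p - s) x + min (s' - p) (x - min (p - s) x) = min (s' - s) x := by omega
      have e1 : y + min (p - s) x + min (s' - p) (x - min (p - s) x) = y + min (s' - s) x := by
        omega
      have e2 : x - min (p - s) x - min (s' - p) (x - min (p - s) x) = x - min (s' - s) x := by
        omega
      rw [e1, e2]
      have hle : ∀ t ∈ flow (y + min (s' - s) x) (x - min (s' - s) x) (s' :: l), p ≤ t := by
        intro t ht
        have := le_of_mem_flow l _ _ s' (by omega) (by omega) hs.2 t ht
        omega
      split_ifs with h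
      · have e3 : s + min (p - s) x = s + min (s' - s) x := by omega
        have e4 : p + min (s' - p) (x - min (p - s) x) = p := by omega
        rw [ins_of_le hle, e3, e4]
      · have e3 : s + min (p - s) x = p := by omega
        have e4 : p + min (s' - p) (x - min (p - s) x) = s + min (s' - s) x := by omega
        rw [e3, e4]

theorem flow_ins {p x : ℤ} {l : List ℤ} (hx : 0 ≤ x) (hl : l.Pairwise (· ≤ ·)) :
    flow x 0 (ins p l) = ins p (flow x 0 l) := by
  cases l with
  | nil => simp [ins, flow, hx]
  | cons s l =>
    by_cases h : s < p
    · simpa only [ins, if_pos h] using flow_cons_ins p l x 0 s hx le_rfl h hl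
    · have h0 : min (p - p) x = 0 := by omega
      have h1 : min (s - p) (0 : ℤ) = 0 := by omega
      rw [ins_of_le (l := flow x 0 (s :: l))]
      · simp [ins, if_neg h, flow, hx, h1]
      · intro t ht
        have := le_of_mem_flow l _ _ s hx le_rfl hl t ht
        omega

theorem pairwise_iterate_flow {x : ℤ} {l : List ℤ} (hx : 0 ≤ x) (hl : l.Pairwise (· ≤ ·)) (N : ℕ) :
    ((flow x 0)^[N] l).Pairwise (· ≤ ·) := by
  induction N with
  | zero => exact hl
  | succ N ih => rw [Function.iterate_succ_apply']; exact pairwise_flow _ _ _ hx le_rfl ih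

theorem pairwise_foldr_ins {l : List ℤ} (hl : l.Pairwise (· ≤ ·)) (F : List ℤ) :
    (F.foldr ins l).Pairwise (· ≤ ·) := by
  induction F with
  | nil => exact hl
  | cons f F ih => exact pairwise_ins ih

theorem flow_foldr_ins {x : ℤ} {l : List ℤ} (hx : 0 ≤ x) (hl : l.Pairwise (· ≤ ·)) (F : List ℤ) :
    flow x 0 (F.foldr ins l) = F.foldr ins (flow x 0 l) := by
  induction F with
  | nil => rfl
  | cons f F ih => simp only [List.foldr_cons, flow_ins hx (pairwise_foldr_ins hl F), ih]

theorem iterate_flow_foldr_ins {x : ℤ} {l : List ℤ} (hx : 0 ≤ x) (hl : l.Pairwise (· ≤ ·))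
    (F : List ℤ) (N : ℕ) :
    (flow x 0)^[N] (F.foldr ins l) = F.foldr ins ((flow x 0)^[N] l) := by
  induction N with
  | zero => rfl
  | succ N ih =>
    rw [Function.iterate_succ_apply', Function.iterate_succ_apply', ih,
      flow_foldr_ins hx (pairwise_iterate_flow hx hl N)]

theorem le_of_mem_sw (l : List (ℕ × ℕ)) : ∀ p : ℤ, ∀ t ∈ sw p l, p ≤ t := by
  induction l with
  | nil => simp [sw]
  | cons b l ih =>
    intro p t ht
    simp only [sw, List.mem_cons] at ht
    rcases ht with rfl | rfl | ht
    · rfl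
    · omega
    · have := ih _ t ht; omega

theorem pairwise_sw (l : List (ℕ × ℕ)) : ∀ p : ℤ, (sw p l).Pairwise (· ≤ ·) := by
  induction l with
  | nil => simp [sw]
  | cons b l ih =>
    intro p
    simp only [sw, List.pairwise_cons, List.mem_cons]
    refine ⟨?_, fun t ht => ?_, ih _⟩
    · rintro t (rfl | ht)
      · omega
      · have := le_of_mem_sw l _ t ht; omega
    · have := le_of_mem_sw l _ t ht; omega

theorem stretch_sw (l : List (ℕ × ℕ)) : ∀ p z : ℤ,
    stretch z (sw p l) = sw (p + z) (l.map fun b => (b.1 + 1, b.2 + 1)) := by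
  induction l with
  | nil => intros; rfl
  | cons b l ih =>
    intro p z
    simp only [sw, stretch, List.map_cons, ih]
    congr 2
    · push_cast; ring
    · congr 1; push_cast; ring

theorem map_pred_succ {l : List (ℕ × ℕ)} (h : ∀ b ∈ l, 1 ≤ b.1 ∧ 1 ≤ b.2) :
    (l.map fun b => (b.1 - 1, b.2 - 1)).map (fun b => (b.1 + 1, b.2 + 1)) = l := by
  rw [List.map_map]
  conv_rhs => rw [← List.map_id l]
  refine List.map_congr_left fun b hb => ?_
  have := h b hb
  ext <;> simp <;> omega

/-- Empty blocks are double entries of the list of change positions. -/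
theorem exists_sw_eq_foldr_ins (l : List (ℕ × ℕ)) (hl : ∀ b ∈ l, b.1 ≤ b.2) : ∀ p : ℤ,
    ∃ (p' : ℤ) (l' : List (ℕ × ℕ)) (F : List ℤ), p ≤ p' ∧
      l'.map Prod.fst = (l.map Prod.fst).filter (fun k => decide (1 ≤ k)) ∧
      (∀ b ∈ l', 1 ≤ b.1 ∧ b.1 ≤ b.2) ∧ (∀ f ∈ F, p ≤ f) ∧ F.Pairwise (· ≤ ·) ∧
      F.length = ((l.map Prod.fst).filter (fun k => ! decide (1 ≤ k))).length ∧
      sw p l = F.foldr ins (sw p' l') := by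
  induction l with
  | nil => exact fun p => ⟨p, [], [], by simp [sw]⟩
  | cons b l ih =>
    intro p
    obtain ⟨p', l', F, h1, h2, h3, h4, h5, h6, h7⟩ :=
      ih (fun b hb => hl b (by simp [hb])) (p + b.1 + b.2)
    have hb := hl b (by simp)
    by_cases h0 : 1 ≤ b.1
    · refine ⟨p, (b.1, (p' - p - b.1).toNat) :: l', F, le_rfl, by simp [h0, h2], ?_, ?_, h5,
        by simp [h0, h6], ?_⟩
      · intro c hc
        rcases List.mem_cons.mp hc with rfl | hc
        · simp only; omega
        · exact h3 c hc
      · intro f hf; have := h4 f hf; omega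
      · have e : p + b.1 + ((p' - p - b.1).toNat : ℤ) = p' := by omega
        simp only [sw, h7, e]
        clear h7 h6 h5
        induction F with
        | nil => rfl
        | cons f F ihF =>
          have := h4 f (by simp)
          rw [List.foldr_cons, List.foldr_cons, ← ihF fun g hg => h4 g (by simp [hg])]
          have h1 : p < f := by omega
          have h2 : p + b.1 < f := by omega
          simp [ins, h1, h2]
    · refine ⟨p', l', p :: F, by omega, by simp [h0, h2], h3, ?_, ?_, by simp [h0, h6], ?_⟩
      · intro f hf
        rcases List.mem_cons.mp hf with rfl | hf
        · rfl
        · have := h4 f hf; omega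
      · rw [List.pairwise_cons]
        exact ⟨fun f hf => by have := h4 f hf; omega, h5⟩
      · rw [List.foldr_cons, ← h7, ins_of_le]
        · have e : p + b.1 = p := by omega
          simp only [sw, e]
        · intro t ht
          have := le_of_mem_sw _ _ t ht
          omega

theorem foldr_ins_of_le {F l : List ℤ} (hF : F.Pairwise (· ≤ ·)) (h : ∀ f ∈ F, ∀ t ∈ l, f ≤ t) :
    F.foldr ins l = (F.flatMap fun f => [f, f]) ++ l := by
  induction F with
  | nil => rfl
  | cons f F ih =>
    rw [List.pairwise_cons] at hF
    rw [List.foldr_cons, ih hF.2 fun g hg => h g (by simp [hg]), ins_of_le]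
    · simp
    · intro t ht
      simp only [List.mem_append, List.mem_flatMap] at ht
      rcases ht with ⟨g, hg, ht⟩ | ht
      · have := hF.1 g hg
        simp at ht; omega
      · exact h f (by simp) t ht

theorem exists_sw_eq_flatMap_append (F : List ℤ) (hF : F.Pairwise (· ≤ ·)) (p : ℤ)
    (l : List (ℕ × ℕ)) (h : ∀ f ∈ F, f ≤ p) :
    ∃ (p' : ℤ) (G : List ℕ), G.length = F.length ∧ (p' = p ∨ p' ∈ F) ∧
      (F.flatMap fun f => [f, f]) ++ sw p l = sw p' (G.map (fun g => (0, g)) ++ l) := by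
  induction F with
  | nil => exact ⟨p, [], by simp⟩
  | cons f F ih =>
    rw [List.pairwise_cons] at hF
    obtain ⟨p', G, h1, h2, h3⟩ := ih hF.2 fun g hg => h g (by simp [hg])
    have hfp : f ≤ p' := by
      rcases h2 with rfl | h2
      · exact h f (by simp)
      · exact hF.1 _ h2
    refine ⟨f, (p' - f).toNat :: G, by simp [h1], by simp, ?_⟩
    simp only [List.flatMap_cons, h3, List.map_cons, List.cons_append, sw,
      List.nil_append]
    congr 2
    · simp
    · congr 1; push_cast; omega

/-- Under the box-ball evolution of capacity `m ≥ 1` a disjoint union of solitons becomes, far to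
the right, again a disjoint union of these solitons. -/
theorem eventually_sw (m : ℕ) : ∀ (l : List (ℕ × ℕ)), (∀ b ∈ l, 1 ≤ b.1 ∧ b.1 ≤ b.2) →
    ∀ p C : ℤ, ∃ N₀ : ℕ, ∀ N ≥ N₀, ∃ (p' : ℤ) (l' : List (ℕ × ℕ)),
      (l'.map Prod.fst).Perm (l.map Prod.fst) ∧ (∀ b ∈ l', b.1 ≤ b.2) ∧ C ≤ p' ∧
      (flow ((m : ℤ) + 1) 0)^[N] (sw p l) = sw p' l' := by
  induction m with
  | zero =>
    intro l hl p C
    refine ⟨(C - p).toNat, fun N hN => ⟨p + N, l, List.Perm.refl _, fun b hb => (hl b hb).2,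
      by omega, ?_⟩⟩
    have h1 : ∀ b ∈ l, 1 ≤ b.1 ∧ 1 ≤ b.2 := fun b hb => ⟨(hl b hb).1, (hl b hb).1.trans (hl b hb).2⟩
    -- At capacity one the shortened word sees a carrier of capacity zero and rests, so the word
    -- itself is translated by one in each step.
    have h0 : ∀ L : List ℤ, L.Pairwise (· ≤ ·) → flow 0 0 L = L := by
      intro L hL
      induction L with
      | nil => rfl
      | cons s L ih =>
        cases L with
        | nil => simp [flow]
        | cons s' L =>
          rw [List.pairwise_cons] at hL
          have := hL.1 s' (by simp)
          have e : min (s' - s) 0 = 0 := by omega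
          simp only [flow, e, add_zero, sub_zero, ih hL.2]
    have h2 := stretch_sw (l.map fun b => (b.1 - 1, b.2 - 1)) p 0
    rw [map_pred_succ h1, add_zero] at h2
    rw [← h2, Nat.cast_zero, iterate_flow_stretch,
      Function.iterate_fixed (h0 _ (pairwise_sw _ _)), stretch_sw, map_pred_succ h1, zero_add]
  | succ m ih =>
    intro l hl p C
    have h1 : ∀ b ∈ l, 1 ≤ b.1 ∧ 1 ≤ b.2 := fun b hb => ⟨(hl b hb).1, (hl b hb).1.trans (hl b hb).2⟩
    have h2 := stretch_sw (l.map fun b => (b.1 - 1, b.2 - 1)) p 0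
    rw [map_pred_succ h1, add_zero] at h2
    obtain ⟨p₁, l₁, F, g1, g2, g3, g4, g5, g6, g7⟩ :=
      exists_sw_eq_foldr_ins (l.map fun b => (b.1 - 1, b.2 - 1)) (by
        intro b hb
        obtain ⟨c, hc, rfl⟩ := List.mem_map.mp hb
        have := hl c hc
        simp only; omega) p
    -- The entries of `F`, from blocks with a single one, stay fixed. Once the other blocks have
    -- passed `C'` the two groups are separated, and stretching back makes `F` a list of single ones
    -- in front of the rest.
    obtain ⟨C', hC'⟩ : ∃ C' : ℤ, p ≤ C' ∧ ∀ f ∈ F, f ≤ C' := by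
      clear g4 g5 g6 g7
      induction F with
      | nil => exact ⟨p, by simp⟩
      | cons f F ihF =>
        obtain ⟨C', h⟩ := ihF
        refine ⟨max C' f, by omega, fun g hg => ?_⟩
        rcases List.mem_cons.mp hg with rfl | hg
        · omega
        · have := h.2 g hg; omega
    obtain ⟨N₀, hN₀⟩ := ih l₁ g3 p₁ C'
    refine ⟨max N₀ (C - p).toNat, fun N hN => ?_⟩
    obtain ⟨p₂, l₂, k1, k2, k3, k4⟩ := hN₀ N (by omega)
    obtain ⟨p₃, G, e1, e2, e3⟩ := exists_sw_eq_flatMap_append F g5 p₂ l₂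
      fun f hf => (hC'.2 f hf).trans k3
    refine ⟨p₃ + N, (G.map (fun g => (0, g)) ++ l₂).map fun b : ℕ × ℕ => (b.1 + 1, b.2 + 1), ?_, ?_, ?_, ?_⟩
    · have hG : G.map (Prod.fst ∘ fun g : ℕ => ((0 : ℕ), g)) =
          ((l.map fun b => (b.1 - 1, b.2 - 1)).map Prod.fst).filter
            (fun k => ! decide (1 ≤ k)) := by
        have : G.map (Prod.fst ∘ fun g : ℕ => ((0 : ℕ), g)) = List.replicate G.length 0 := by
          simp [Function.comp_def]
        rw [this, e1, g6, eq_comm, List.eq_replicate_iff]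
        refine ⟨rfl, fun b hb => ?_⟩
        simp only [List.mem_filter, Bool.not_eq_true', decide_eq_false_iff_not] at hb
        omega
      have hp : (l.map Prod.fst) =
          (((l.map fun b => (b.1 - 1, b.2 - 1)).map Prod.fst).map (· + 1)) := by
        conv_lhs => rw [← map_pred_succ h1]
        simp only [List.map_map]; rfl
      rw [hp, List.map_map]
      have : (Prod.fst ∘ fun b : ℕ × ℕ => (b.1 + 1, b.2 + 1)) = (· + 1) ∘ Prod.fst := rfl
      rw [this, ← List.map_map]
      refine List.Perm.map _ ?_
      rw [List.map_append, List.map_map, hG]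
      refine (List.Perm.append_left _ k1).trans ?_
      rw [g2]
      exact List.perm_append_comm.trans (List.filter_append_perm _ _)
    · intro b hb
      obtain ⟨c, hc, rfl⟩ := List.mem_map.mp hb
      simp only
      rcases List.mem_append.mp hc with hc | hc
      · obtain ⟨g, -, rfl⟩ := List.mem_map.mp hc; simp
      · have := k2 c hc; omega
    · have : p ≤ p₃ := by
        rcases e2 with rfl | e2
        · omega
        · exact g4 _ e2
      omega
    · rw [← h2]
      push_cast
      rw [iterate_flow_stretch, g7, iterate_flow_foldr_ins (by omega) (pairwise_sw _ _), k4,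
        foldr_ins_of_le g5, e3, stretch_sw, zero_add]
      intro f hf t ht
      have := le_of_mem_sw _ _ t ht
      have := hC'.2 f hf
      omega

/-! ### The evolution as a local rule with a carrier load -/

/-- The number of change positions up to `x`; the letter at `x` is `1` if it is odd. -/
def cnt (L : List ℤ) (x : ℤ) : ℕ := L.countP (· ≤ x)

theorem cnt_cons (s : ℤ) (L : List ℤ) (x : ℤ) :
    cnt (s :: L) x = cnt L x + if s ≤ x then 1 else 0 := by
  simp [cnt, List.countP_cons]

theorem cnt_eq_zero {L : List ℤ} {x : ℤ} (h : ∀ s ∈ L, x < s) : cnt L x = 0 := by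
  simpa [cnt, List.countP_eq_zero] using h

theorem cnt_mono (L : List ℤ) {x x' : ℤ} (h : x ≤ x') : cnt L x ≤ cnt L x' :=
  List.countP_mono_left fun s _ hs => by simp at hs ⊢; omega

/-- No position occurs twice among the change positions. -/
def Thin (L : List ℤ) : Prop := ∀ x, cnt L (x + 1) ≤ cnt L x + 1

theorem thin_of_pairwise {L : List ℤ} (h : L.Pairwise (· < ·)) : Thin L := by
  induction L with
  | nil => intro x; simp [cnt]
  | cons s L ih =>
    intro x
    rw [List.pairwise_cons] at h
    have := ih h.2 x
    simp only [cnt_cons]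
    by_cases h1 : s ≤ x
    · rw [if_pos h1, if_pos (by omega)]; omega
    · by_cases h2 : s ≤ x + 1
      · have : cnt L (x + 1) = 0 := cnt_eq_zero fun t ht => by have := h.1 t ht; omega
        rw [if_pos h2]; omega
      · rw [if_neg h2]; omega

/-- The local rule of the box-ball system: `k` and `k'` count the changes in the old and in the
new word, and `y`, `y'` are the loads of a carrier of capacity `c` before and after a letter. -/
def Rule (c : ℤ) (k k' : ℕ) (y y' : ℤ) : Prop :=
  (k % 2 = 1 ∧ y < c ∧ k' + 1 = k ∧ y' = y + 1) ∨ (k % 2 = 1 ∧ y = c ∧ k' = k ∧ y' = y) ∨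
  (k % 2 = 0 ∧ 0 < y ∧ k' + 1 = k ∧ y' = y - 1) ∨ (k % 2 = 0 ∧ y = 0 ∧ k' = k ∧ y' = y)

/-- The rule is symmetric under exchanging ones with zeros and the load `y` with the free space `c -
y`. Dropping the first change exchanges the letters, so the load behind `s'` is `c` minus the load
given by induction. -/
theorem exists_rule_flow_cons (c : ℤ) (l : List ℤ) : ∀ (s y₀ : ℤ), 0 ≤ y₀ → y₀ ≤ c →
    (s :: l).Pairwise (· ≤ ·) →
    ∃ y : ℤ → ℤ, (∀ z ≤ s, y z = y₀) ∧ (∀ z, 0 ≤ y z ∧ y z ≤ c) ∧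
      ∀ z, s ≤ z → Rule c (cnt (s :: l) z) (cnt (flow (c - y₀) y₀ (s :: l)) z) (y z) (y (z + 1)) := by
  induction l with
  | nil =>
    intro s y₀ h0 h1 _
    refine ⟨fun z => if z ≤ s then y₀ else min c (y₀ + (z - s)), fun z hz => if_pos hz, ?_, ?_⟩
    · intro z; simp only; split_ifs <;> omega
    · intro z hz
      simp only [flow, cnt_cons, Rule, if_pos hz]
      have : cnt [] z = 0 := rfl
      rw [this, if_neg (show ¬ z + 1 ≤ s by omega)]
      split_ifs <;> omega
  | cons s' l ih =>
    intro s y₀ h0 h1 hs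
    rw [List.pairwise_cons] at hs
    have hss := hs.1 s' (by simp)
    obtain ⟨y, hy1, hy2, hy3⟩ := ih s' (c - (y₀ + min (s' - s) (c - y₀))) (by omega) (by omega) hs.2
    refine ⟨fun z => if z ≤ s then y₀ else if z ≤ s' then y₀ + min (z - s) (c - y₀) else c - y z,
      fun z hz => if_pos hz, ?_, ?_⟩
    · intro z; have := hy2 z; simp only; split_ifs <;> omega
    · intro z hz
      have e1 : c - (c - (y₀ + min (s' - s) (c - y₀))) = y₀ + min (s' - s) (c - y₀) := by ring
      have e2 : c - (y₀ + min (s' - s) (c - y₀)) = c - y₀ - min (s' - s) (c - y₀) := by ring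
      rw [e1, e2] at hy3
      simp only [flow]
      rw [cnt_cons s, cnt_cons (s + _), if_pos hz]
      by_cases hz' : s' ≤ z
      · have := hy3 z hz'
        have hm : s + min (s' - s) (c - y₀) ≤ z := by omega
        rw [if_pos hm]
        have h2 := hy2 z
        have h3 := hy1 z
        rw [if_neg (show ¬ z + 1 ≤ s by omega), if_neg (show ¬ z + 1 ≤ s' by omega)]
        have e : (if z ≤ s then y₀ else if z ≤ s' then y₀ + min (z - s) (c - y₀) else c - y z) =
            c - y z := by
          split_ifs <;> omega
        rw [e]
        generalize cnt (s' :: l) z = k at *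
        generalize cnt (flow _ _ (s' :: l)) z = k' at *
        unfold Rule at this ⊢
        omega
      · have hk : cnt (s' :: l) z = 0 := cnt_eq_zero fun t ht => by
          rcases List.mem_cons.mp ht with rfl | ht
          · omega
          · have := (List.pairwise_cons.mp hs.2).1 t ht; omega
        have hk' : cnt (flow (y₀ + min (s' - s) (c - y₀)) (c - y₀ - min (s' - s) (c - y₀))
            (s' :: l)) z = 0 := cnt_eq_zero fun t ht => by
          have := le_of_mem_flow l _ _ s' (by omega) (by omega) hs.2 t ht; omega
        rw [hk, hk', if_neg (show ¬ z + 1 ≤ s by omega), if_pos (show z + 1 ≤ s' by omega)]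
        unfold Rule
        split_ifs <;> omega

theorem exists_rule_flow {c : ℤ} {L : List ℤ} (hc : 0 ≤ c) (hL : L.Pairwise (· ≤ ·)) {m : ℤ}
    (hm : ∀ s ∈ L, m ≤ s) :
    ∃ y : ℤ → ℤ, (∀ z ≤ m, y z = 0) ∧ (∀ z, 0 ≤ y z ∧ y z ≤ c) ∧
      ∀ z, Rule c (cnt L z) (cnt (flow c 0 L) z) (y z) (y (z + 1)) := by
  cases L with
  | nil => exact ⟨0, by simp, by simpa using hc, fun z => by simp [Rule, cnt, flow]⟩
  | cons s l =>
    obtain ⟨y, h1, h2, h3⟩ := exists_rule_flow_cons c l s 0 le_rfl hc hL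
    rw [sub_zero] at h3
    refine ⟨y, fun z hz => h1 z (hz.trans (hm s (by simp))), h2, fun z => ?_⟩
    by_cases hz : s ≤ z
    · exact h3 z hz
    · have e1 : cnt (s :: l) z = 0 := cnt_eq_zero fun t ht => by
        rcases List.mem_cons.mp ht with rfl | ht
        · omega
        · have := (List.pairwise_cons.mp hL).1 t ht; omega
      have e2 : cnt (flow c 0 (s :: l)) z = 0 := cnt_eq_zero fun t ht => by
        have := le_of_mem_flow l _ _ s hc le_rfl hL t ht; omega
      rw [e1, e2, h1 z (by omega), h1 (z + 1) (by omega)]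
      simp [Rule]

/-! ### Ranks of letters and their motion -/

/-- `x` is the first letter of a run of ones. -/
def Asc (L : List ℤ) (x : ℤ) : Prop := cnt L x % 2 = 1 ∧ cnt L (x - 1) % 2 = 0

/-- `x` minus the number of runs of ones which start at or before `x`. -/
def rank (L : List ℤ) (x : ℤ) : ℤ := x - ((cnt L x + 1) / 2 : ℕ)

theorem rank_mono {L : List ℤ} (hL : Thin L) {x x' : ℤ} (h : x ≤ x') : rank L x ≤ rank L x' := by
  induction x', h using Int.leInduction with
  | base => rfl
  | succ x' _ ih =>
    have := hL x'
    have := cnt_mono L (show x' ≤ x' + 1 by omega)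
    unfold rank at *
    omega

/-- In a thin list at most one run begins at each letter, so the rank goes up by one at each step to
the right, except at the first letter of a run of ones, where it stalls. -/
theorem rank_lt {L : List ℤ} (hL : Thin L) {x x' : ℤ} (h : x < x') (h' : ¬ Asc L x') :
    rank L x < rank L x' := by
  have h1 := rank_mono hL (show x ≤ x' - 1 by omega)
  have h2 := hL (x' - 1)
  have h3 := cnt_mono L (show x' - 1 ≤ x' by omega)
  rw [sub_add_cancel] at h2
  unfold rank Asc at *
  omega

theorem rank_injOn {L : List ℤ} (hL : Thin L) {x x' : ℤ} (hx : ¬ Asc L x) (hx' : ¬ Asc L x')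
    (h : rank L x = rank L x') : x = x' := by
  rcases lt_trichotomy x x' with h1 | h1 | h1
  · exact absurd h (rank_lt hL h1 hx').ne
  · exact h1
  · exact absurd h (rank_lt hL h1 hx).ne'

section Evolution

variable {c : ℤ} {L L' : List ℤ} {y : ℤ → ℤ}

/-- After an exchange the carrier is certainly able to exchange a letter of the other kind. Hence
the new count cannot lag behind at `z`, catch up at `z + 1`, and meet an old change there as well.
-/
theorem thin_of_rule (hL : Thin L)
    (hy : ∀ z, 0 ≤ y z ∧ y z ≤ c) (h : ∀ z, Rule c (cnt L z) (cnt L' z) (y z) (y (z + 1))) :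
    Thin L' := by
  intro z
  have h1 := h z
  have h2 := h (z + 1)
  have h3 := hy z
  have h4 := hy (z + 1)
  have h5 := hL z
  unfold Rule at h1 h2
  omega

/-- A basket on a letter which changes from `1` to `0` stays. -/
theorem rank_stay (h : ∀ z, Rule c (cnt L z) (cnt L' z) (y z) (y (z + 1))) {x : ℤ}
    (hx : ¬ Asc L x) (hD : cnt L x % 2 = 1) (hD' : cnt L' x % 2 = 0) :
    ¬ Asc L' x ∧ rank L' x = rank L x + 1 := by
  have h1 := h x
  unfold Rule at h1
  unfold Asc rank at *
  omega

/-- The other baskets move by one step. -/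
theorem rank_move (hc : 1 ≤ c) (hL : Thin L)
    (hy : ∀ z, 0 ≤ y z ∧ y z ≤ c) (h : ∀ z, Rule c (cnt L z) (cnt L' z) (y z) (y (z + 1))) {x : ℤ}
    (hD : ¬ (cnt L x % 2 = 1 ∧ cnt L' x % 2 = 0)) :
    ¬ Asc L' (x + 1) ∧ rank L' (x + 1) = rank L x + 1 := by
  have h1 := h x
  have h2 := h (x + 1)
  have h3 := hy x
  have h4 := hy (x + 1)
  have h5 := hL x
  have h6 := cnt_mono L (show x ≤ x + 1 by omega)
  have h7 := thin_of_rule hL hy h x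
  have h8 := cnt_mono L' (show x ≤ x + 1 by omega)
  unfold Rule at h1 h2
  unfold Asc rank
  rw [add_sub_cancel_right]
  omega

/-- The load of the carrier along a run of ones. -/
theorem load_of_ones (hy : ∀ z, 0 ≤ y z ∧ y z ≤ c)
    (h : ∀ z, Rule c (cnt L z) (cnt L' z) (y z) (y (z + 1)))
    {p q : ℤ} (hpq : ∀ x, p ≤ x → x < q → cnt L x % 2 = 1) {x : ℤ} (hx : p ≤ x) (hx' : x ≤ q) :
    y x = min c (y p + (x - p)) := by
  induction x, hx using Int.leInduction with
  | base => have := hy p; omega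
  | succ x hx ih =>
    have h1 := h x
    have h2 := hpq x hx (by omega)
    have h3 := ih (by omega)
    unfold Rule at h1
    omega

/-- The load of the carrier along a run of zeros. -/
theorem load_of_zeros (hy : ∀ z, 0 ≤ y z ∧ y z ≤ c)
    (h : ∀ z, Rule c (cnt L z) (cnt L' z) (y z) (y (z + 1)))
    {p q : ℤ} (hpq : ∀ x, p ≤ x → x < q → cnt L x % 2 = 0) {x : ℤ} (hx : p ≤ x) (hx' : x ≤ q) :
    y x = max 0 (y p - (x - p)) := by
  induction x, hx using Int.leInduction with
  | base => have := hy p; omega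
  | succ x hx ih =>
    have h1 := h x
    have h2 := hpq x hx (by omega)
    have h3 := ih (by omega)
    unfold Rule at h1
    omega

/-- The box-ball evolution of a block of `f` ones and `e + 1 - f` zeros. -/
theorem evolve_block (hy : ∀ z, 0 ≤ y z ∧ y z ≤ c)
    (h : ∀ z, Rule c (cnt L z) (cnt L' z) (y z) (y (z + 1)))
    {p e f : ℤ} (hf : 0 ≤ f) (hfe : f ≤ e + 1)
    (hp : ∀ x, p ≤ x → x < p + e + 1 → (cnt L x % 2 = 1 ↔ x < p + f)) :
    y (p + e + 1) = y p + min f (c - y p) - min (y p + min f (c - y p)) (e + 1 - f) ∧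
    ∀ x, p ≤ x → x < p + e + 1 → (cnt L' x % 2 = 1 ↔
      p + min f (c - y p) ≤ x ∧ x < p + f + min (y p + min f (c - y p)) (e + 1 - f)) := by
  have hp0 := hy p
  have h1 : ∀ x, p ≤ x → x ≤ p + f → y x = min c (y p + (x - p)) := fun x hx hx' =>
    load_of_ones hy h (p := p) (q := p + f) (fun z hz hz' => (hp z hz (by omega)).2 hz') hx hx'
  have h2 : ∀ x, p + f ≤ x → x ≤ p + e + 1 → y x = max 0 (y (p + f) - (x - (p + f))) :=
    fun x hx hx' => load_of_zeros hy h (p := p + f) (q := p + e + 1)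
      (fun z hz hz' => by have := hp z (by omega) hz'; omega) hx hx'
  have h3 := h1 (p + f) (by omega) le_rfl
  refine ⟨?_, fun x hx hx' => ?_⟩
  · have := h2 (p + e + 1) (by omega) le_rfl
    omega
  · have h4 := h x
    have h5 := hp x hx hx'
    unfold Rule at h4
    by_cases hxf : x < p + f
    · have := h1 x hx (by omega)
      omega
    · have := h2 x (by omega) (by omega)
      omega

end Evolution

/-! ### The carrier with baskets at a single site -/

theorem minP_coe (a b c : ℤ) (S : Site) :
    minP ⟨(a : WithTop ℤ), b, c⟩ S = min (min (a + b) (a + c)) (b + S.c) := by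
  simp only [minP, ← WithTop.coe_add, ← WithTop.coe_min, WithTop.untopD_coe]

theorem minQ_coe (a b c : ℤ) (S : Site) :
    minQ ⟨(a : WithTop ℤ), b, c⟩ S = min (a + S.b) (min (S.a + S.c) (S.b + S.c)) := by
  simp only [minQ, ← WithTop.coe_add, ← WithTop.coe_min, WithTop.untopD_coe]

theorem minP_top (b c : ℤ) (S : Site) : minP ⟨⊤, b, c⟩ S = b + S.c := by
  simp only [minP, top_add, min_self, top_inf_eq, WithTop.untopD_coe]

theorem minQ_top (b c : ℤ) (S : Site) :
    minQ ⟨⊤, b, c⟩ S = min (S.a + S.c) (S.b + S.c) := by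
  simp only [minQ, top_add, top_inf_eq, WithTop.untopD_coe]

/-- The carrier with `b` baskets and `c` balls, of infinite capacity or of capacity `q`. -/
def loaded (ℓ : ℕ∞) (q b c : ℤ) : Carrier :=
  ⟨if ℓ = ⊤ then ⊤ else ((q + b - c : ℤ) : WithTop ℤ), b, c⟩

/-- `q` is the capacity `ℓ`, or `ℓ` is infinite. -/
def Fits (ℓ : ℕ∞) (q : ℤ) : Prop := ℓ = ⊤ ∨ ∃ n : ℕ, ℓ = n ∧ q = n

theorem initialCarrier_eq {ℓ : ℕ∞} {q : ℤ} (h : Fits ℓ q) : initialCarrier ℓ = loaded ℓ q 0 0 := by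
  rcases h with rfl | ⟨n, rfl, rfl⟩
  · rfl
  · simp only [initialCarrier, loaded, ENat.natCast_ne_top, if_false, add_zero, sub_zero]
    rfl

/-- Carried balls fill carried baskets first, and only the surplus `y` is the load of the box-ball
carrier. Then `d` is the number of ones it takes from the block, and the new ones of the block lie
in `[d, d')`. The site receives all carried baskets and keeps its first `max d 1` letters, the box
among them; the box holds a ball exactly if `d = 0 < d'`. For infinite capacity, `htop` says that
`q` never limits the exchange. -/
theorem loaded_evolve {ℓ : ℕ∞} {q b c y : ℤ} {s : Site} (h : Fits ℓ q) (hq : 1 ≤ q)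
    (hy : y = max (c - b) 0) (hyq : y ≤ q) (hsa : s.a = s.b - s.c + 1)
    (hse : 0 ≤ s.b) (hsc : 0 ≤ s.c) (hsb : s.c ≤ s.b + 1) (htop : ℓ = ⊤ → y + s.c ≤ q ∧ y < q) {d d' : ℤ}
    (hd : d = min s.c (q - y)) (hd' : d' = s.c + min (y + d) (s.b + 1 - s.c)) :
    newCarrier (loaded ℓ q b c) s = loaded ℓ q (s.b + 1 - max d 1)
      (c + s.c - (min b c + max 0 (min 1 d' - d))) ∧
    newSite (loaded ℓ q b c) s = ⟨b + max d 1 - 1 - (min b c + max 0 (min 1 d' - d)) + 1,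
      b + max d 1 - 1, min b c + max 0 (min 1 d' - d)⟩ := by
  obtain ⟨sa, e, f⟩ := s
  simp only at *
  subst hsa
  by_cases hl : ℓ = ⊤
  · have := htop hl
    subst hl
    simp only [loaded, if_true, newCarrier, newSite, minP_top, minQ_top, minR, top_add,
      Carrier.mk.injEq, Site.mk.injEq, true_and]
    omega
  · simp only [loaded, if_neg hl, newCarrier, newSite, minP_coe, minQ_coe, minR,
      ← WithTop.coe_add, Carrier.mk.injEq, Site.mk.injEq, WithTop.coe_inj]
    have hQ : min (q + b - c + e) (min (e - f + 1 + f) (e + f)) = e + min d 1 := by omega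
    have hP : min (min (q + b - c + b) (q + b - c + c)) (b + f) = b + d := by omega
    rw [hP, hQ]
    rcases hsc.eq_or_lt with h0 | h0
    · have h1 : d = 0 := by omega
      have hR : min (min (e + c) (e - f + 1 + c)) (e - f + 1 + b) = e + min c (b + 1) := by omega
      rw [hR]
      clear hP hQ hR
      subst h0 h1
      omega
    · have hR : min (min (e + c) (e - f + 1 + c)) (e - f + 1 + b) = e - f + 1 + min c b := by omega
      have h1 : max 0 (min 1 d' - d) = 1 - min d 1 := by omega
      rw [hR, h1]
      clear hP hQ hR
      omega

theorem newCarrier_vacuum {ℓ : ℕ∞} : newCarrier (initialCarrier ℓ) V = initialCarrier ℓ := by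
  induction ℓ using ENat.recTopCoe with
  | top =>
    have : initialCarrier ⊤ = ⟨⊤, 0, 0⟩ := rfl
    rw [this]
    simp [newCarrier, minP_top, minQ_top, minR, V]
  | coe n =>
    have : initialCarrier (n : ℕ∞) = ⟨((n : ℤ) : WithTop ℤ), 0, 0⟩ := rfl
    rw [this]
    simp only [newCarrier, minP_coe, minQ_coe, minR, V, ← WithTop.coe_add, Carrier.mk.injEq,
      WithTop.coe_inj]
    omega

section Carrier

variable {ℓ : ℕ∞} {S : State} {m : ℤ} (hm : ∀ i < m, S i = V)

theorem carrierAt_of_le_leftEnd {i : ℤ} (hi : i ≤ leftEnd S) :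
    carrierAt ℓ S i = initialCarrier ℓ := by
  rw [carrierAt, Int.toNat_of_nonpos (by omega), carrierFrom]

include hm in
theorem eq_vacuum_of_lt_leftEnd {i : ℤ} (hi : i < leftEnd S) : S i = V := by
  by_contra h
  have hb : BddBelow {i | S i ≠ V} := ⟨m, fun j hj => by
    by_contra hjm
    exact hj (hm j (by omega))⟩
  exact absurd (csInf_le hb h) (not_le.mpr hi)

include hm in
theorem carrierAt_succ (i : ℤ) :
    carrierAt ℓ S (i + 1) = newCarrier (carrierAt ℓ S i) (S i) := by
  by_cases h : leftEnd S ≤ i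
  · have e : (i + 1 - leftEnd S).toNat = (i - leftEnd S).toNat + 1 := by omega
    have e' : leftEnd S + ((i - leftEnd S).toNat : ℤ) = i := by omega
    rw [carrierAt, e, carrierFrom, e', carrierAt]
  · rw [carrierAt_of_le_leftEnd (by omega), carrierAt_of_le_leftEnd (by omega),
      eq_vacuum_of_lt_leftEnd hm (by omega), newCarrier_vacuum]

include hm in
theorem carrierAt_of_le {i : ℤ} (hi : i ≤ m) : carrierAt ℓ S i = initialCarrier ℓ := by
  by_cases h : i ≤ leftEnd S
  · exact carrierAt_of_le_leftEnd h
  · have h' : leftEnd S ≤ i := by omega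
    induction i, h' using Int.leInduction with
    | base => exact carrierAt_of_le_leftEnd le_rfl
    | succ i h' ih =>
      rw [carrierAt_succ hm, hm i (by omega)]
      by_cases h2 : i ≤ leftEnd S
      · rw [carrierAt_of_le_leftEnd h2, newCarrier_vacuum]
      · rw [ih (by omega) h2 , newCarrier_vacuum]

end Carrier

/-! ### Encoding of states by a word and a set of ranks -/

/-- The state `S` is the word with the change positions `L`, cut into sites such that site `i`
starts at position `pos i`, where the baskets are the elements of rank in `β`. -/
structure Enc (S : State) (L : List ℤ) (β : Set ℤ) (pos : ℤ → ℤ) (m : ℤ) : Prop where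
  left : ∀ i ≤ m, pos i = i
  succ : ∀ i, pos (i + 1) = pos i + (S i).b + 1
  free : ∀ i, (S i).a = (S i).b - (S i).c + 1
  baskets_nonneg : ∀ i, 0 ≤ (S i).b
  balls_nonneg : ∀ i, 0 ≤ (S i).c
  balls_le : ∀ i, (S i).c ≤ (S i).b + 1
  word : ∀ i x, pos i ≤ x → x < pos (i + 1) → (cnt L x % 2 = 1 ↔ x < pos i + (S i).c)
  le_changes : ∀ s ∈ L, m ≤ s
  rank_mem : ∀ i x, pos i < x → x < pos (i + 1) → ¬ Asc L x ∧ rank L x ∈ β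
  exists_rank : ∀ b ∈ β, ∃ i x, pos i < x ∧ x < pos (i + 1) ∧ rank L x = b

namespace Enc

variable {S S' : State} {L : List ℤ} {β : Set ℤ} {pos pos' : ℤ → ℤ} {m m' : ℤ}

theorem vacuum (h : Enc S L β pos m) {i : ℤ} (hi : i < m) : S i = V := by
  have h1 := h.left i hi.le
  have h2 := h.left (i + 1) (by omega)
  have h3 := h.succ i
  have h4 := h.free i
  have h5 := (h.word i i (by omega) (by omega)).mpr
  have h6 : cnt L i = 0 := cnt_eq_zero fun s hs => by have := h.le_changes s hs; omega
  have h7 := h.balls_nonneg i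
  rw [h6] at h5
  have h8 : (S i).c = 0 := by
    by_contra h9
    have := h5 (by omega)
    omega
  ext <;> simp only [V] <;> omega

theorem pos_mono (h : Enc S L β pos m) {i j : ℤ} (hij : i ≤ j) : pos i ≤ pos j := by
  induction j, hij using Int.leInduction with
  | base => rfl
  | succ j _ ih => have := h.succ j; have := h.baskets_nonneg j; omega

theorem pos_ne (h : Enc S L β pos m) {i j x : ℤ} (h1 : pos i < x) (h2 : x < pos (i + 1)) :
    pos j ≠ x := by
  intro hj
  by_cases hij : j ≤ i
  · have := h.pos_mono hij; omega
  · have := h.pos_mono (show i + 1 ≤ j by omega); omega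

theorem mono (h : Enc S L β pos m) {m₁ : ℤ} (hm : m₁ ≤ m) : Enc S L β pos m₁ :=
  { h with
    left := fun i hi => h.left i (by omega)
    le_changes := fun s hs => hm.trans (h.le_changes s hs) }

/-- Otherwise a box of one cutting would be a basket of the other. Its rank lies in `β`, so the
first cutting too has a basket of this rank, by injectivity at the same position, which is that of a
box. -/
theorem not_pos_succ_lt (hL : Thin L) (h : Enc S L β pos m) (h' : Enc S' L β pos' m') {i : ℤ}
    (hi : pos i = pos' i) : ¬ pos (i + 1) < pos' (i + 1) := by
  intro hlt
  have h1 := h.succ i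
  have h2 := h.baskets_nonneg i
  obtain ⟨h3, h4⟩ := h'.rank_mem i (pos (i + 1)) (by omega) hlt
  obtain ⟨j, x, h5, h6, h7⟩ := h.exists_rank _ h4
  have := rank_injOn hL (h.rank_mem j x h5 h6).1 h3 h7
  exact h.pos_ne h5 h6 this.symm

theorem unique (hL : Thin L) (h : Enc S L β pos m) (h' : Enc S' L β pos' m') : S = S' := by
  wlog hm : m = m' generalizing m m'
  · exact this (h.mono (min_le_left m m')) (h'.mono (min_le_right m m')) rfl
  subst hm
  have hpos : ∀ i, pos i = pos' i := by
    intro i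
    by_cases hi : i ≤ m
    · rw [h.left i hi, h'.left i hi]
    · have hi' : m ≤ i := by omega
      clear hi
      induction i, hi' using Int.leInduction with
      | base => rw [h.left m le_rfl, h'.left m le_rfl]
      | succ i _ ih =>
        have h1 := not_pos_succ_lt hL h h' ih
        have h2 := not_pos_succ_lt hL h' h ih.symm
        omega
  have hb : ∀ i, (S i).b = (S' i).b := fun i => by
    have h1 := h.succ i
    have h2 := h'.succ i
    rw [← hpos, ← hpos] at h2
    omega
  have hc : ∀ i, (S i).c = (S' i).c := fun i => by
    have h1 := h.succ i
    have h2 := h.balls_nonneg i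
    have h3 := h.balls_le i
    have h4 := h'.balls_nonneg i
    have h5 := h'.balls_le i
    have h6 := hb i
    have hw := h.word i
    have hw' := h'.word i
    rw [← hpos, ← hpos] at hw'
    rcases lt_trichotomy (S i).c (S' i).c with hlt | heq | hlt
    · have e1 := hw (pos i + (S i).c) (by omega) (by omega)
      have e2 := hw' (pos i + (S i).c) (by omega) (by omega)
      omega
    · exact heq
    · have e1 := hw (pos i + (S' i).c) (by omega) (by omega)
      have e2 := hw' (pos i + (S' i).c) (by omega) (by omega)
      omega
  funext i
  have h1 := h.free i
  have h2 := h'.free i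
  have := hb i
  have := hc i
  ext <;> omega

/-- A carrier with `b` baskets and `c` balls arrives at site `i`; the baskets are filled from the
left. -/
structure Arrives (S : State) (L' : List ℤ) (y : ℤ → ℤ) (pos : ℤ → ℤ) (ℓ : ℕ∞) (q i b c : ℤ) :
    Prop where
  carrier : carrierAt ℓ S i = loaded ℓ q b c
  baskets_nonneg : 0 ≤ b
  balls_nonneg : 0 ≤ c
  load : y (pos i) = max (c - b) 0
  word : ∀ x, pos i - b ≤ x → x < pos i → (cnt L' x % 2 = 1 ↔ x < pos i - b + min b c)

variable {ℓ : ℕ∞} {q : ℤ} {L' : List ℤ} {y : ℤ → ℤ}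

/-- Think of the carried baskets as the `b` letters just before `pos i`. The new site consists of
them and of the letters of the old site that turn from one to zero, `d` in number, or of the box
alone if `d = 0`. The remaining baskets of the old site travel on. -/
theorem arrives_succ (hℓ : Fits ℓ q) (hq : 1 ≤ q) (h : Enc S L β pos m)
    (hy : ∀ z, 0 ≤ y z ∧ y z ≤ q) (htop : ℓ = ⊤ → ∀ z, y z < q)
    (hr : ∀ z, Rule q (cnt L z) (cnt L' z) (y z) (y (z + 1))) {i b c : ℤ}
    (hA : Arrives S L' y pos ℓ q i b c) : ∃ b' c' d C : ℤ,
      Arrives S L' y pos ℓ q (i + 1) b' c' ∧ b' = (S i).b + 1 - max d 1 ∧ max d 1 ≤ (S i).b + 1 ∧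
      T ℓ S i = ⟨b + max d 1 - 1 - C + 1, b + max d 1 - 1, C⟩ ∧ 0 ≤ C ∧ C ≤ b + max d 1 ∧
      (∀ x, pos i ≤ x → x < pos (i + 1) →
        (cnt L x % 2 = 1 ∧ cnt L' x % 2 = 0 ↔ x < pos i + d)) ∧
      ∀ x, pos i - b ≤ x → x < pos i + max d 1 → (cnt L' x % 2 = 1 ↔ x < pos i - b + C) := by
  obtain ⟨h1, h2, h3, h4, h5⟩ := hA
  have hs := h.succ i
  have hse := h.baskets_nonneg i
  have hsc := h.balls_nonneg i
  have hsb := h.balls_le i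
  have hw := h.word i
  rw [hs] at hw
  have hyp := hy (pos i)
  have hwc : ∀ x, pos i ≤ x → x < pos i + (S i).b + 1 →
      (cnt L x % 2 = 1 ↔ x < pos i + (S i).c) := hw
  obtain ⟨k1, k2⟩ := evolve_block hy hr hsc hsb hwc
  have hones := load_of_ones hy hr (p := pos i) (q := pos i + (S i).c)
    (fun z hz hz' => (hw z hz (by omega)).2 hz') (x := pos i + (S i).c) (by omega) le_rfl
  obtain ⟨d, hd⟩ : ∃ d, d = min (S i).c (q - y (pos i)) := ⟨_, rfl⟩
  obtain ⟨d', hd'⟩ : ∃ d', d' = (S i).c + min (y (pos i) + d) ((S i).b + 1 - (S i).c) := ⟨_, rfl⟩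
  obtain ⟨g1, g2⟩ := loaded_evolve hℓ hq h4 hyp.2 (h.free i) hse hsc hsb (by
    intro ht
    have e1 := htop ht (pos i)
    have e2 := htop ht (pos i + (S i).c)
    omega) hd hd'
  rw [← hd] at k1 k2
  obtain ⟨C, hC⟩ : ∃ C, C = min b c + max 0 (min 1 d' - d) := ⟨_, rfl⟩
  rw [← hC] at g1 g2
  rw [← h1] at g1 g2
  have hd0 : 0 ≤ d ∧ d ≤ (S i).c := by omega
  have hdd : d ≤ d' := by omega
  have hd1 : d' ≤ (S i).b + 1 := by omega
  -- If no ball is taken but the new block contains ones, the carrier has a surplus of balls, so it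
  -- leaves full baskets and a full box; the ones before and behind `pos i` then join up.
  have hC1 : d' - d = 0 ∨ 1 ≤ d ∨ b < c ∧ C = b + 1 := by
    rcases hsc.eq_or_lt with h0 | h0 <;> omega
  have k2' : ∀ x, pos i ≤ x → x < pos i + (S i).b + 1 →
      (cnt L' x % 2 = 1 ↔ pos i + d ≤ x ∧ x < pos i + d') := fun x hx hx' => by
    have := k2 x hx hx'; omega
  have hCb : C ≤ b + max d 1 := by omega
  refine ⟨(S i).b + 1 - max d 1, c + (S i).c - C, d, C, ⟨?_, ?_, ?_, ?_, ?_⟩, rfl, ?_, g2, ?_, ?_,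
    ?_, ?_⟩
  · rw [carrierAt_succ (fun j hj => h.vacuum hj), g1]
  · omega
  · omega
  · rw [hs, k1]
    clear k1 k2 g1 g2 hw hwc h5 hones
    rcases le_or_gt 1 d with h0 | h0
    · have : C = min b c := by omega
      omega
    · have : d = 0 := by omega
      omega
  · intro x hx hx'
    rw [hs] at hx hx' ⊢
    rw [k2' x (by omega) (by omega)]
    clear k1 k2 g1 g2 hw hwc h5 hones
    rcases le_or_gt 1 d with h0 | h0
    · have : C = min b c := by omega
      omega
    · have : d = 0 := by omega
      omega
  · omega
  · omega
  · exact hCb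
  · intro x hx hx'
    rw [hs] at hx'
    have e1 := hw x hx (by omega)
    have e2 := k2' x hx (by omega)
    omega
  · intro x hx hx'
    rcases lt_or_ge x (pos i) with hxp | hxp
    · rw [h5 x hx hxp]
      omega
    · rw [k2' x hxp (by omega)]
      omega

theorem exists_arrives (hℓ : Fits ℓ q) (hq : 1 ≤ q) (h : Enc S L β pos m)
    (hm : ∀ z ≤ m, y z = 0) (hy : ∀ z, 0 ≤ y z ∧ y z ≤ q) (htop : ℓ = ⊤ → ∀ z, y z < q)
    (hr : ∀ z, Rule q (cnt L z) (cnt L' z) (y z) (y (z + 1))) (i : ℤ) :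
    ∃ b c, Arrives S L' y pos ℓ q i b c ∧ (i ≤ m → b = 0) := by
  by_cases hi : i ≤ m
  · refine ⟨0, 0, ⟨?_, le_rfl, le_rfl, ?_, ?_⟩, fun _ => rfl⟩
    · rw [carrierAt_of_le (fun j hj => h.vacuum hj) hi, initialCarrier_eq hℓ]
    · rw [h.left i hi, hm i hi]; simp
    · intro x _ _; omega
  · have hi' : m ≤ i := by omega
    suffices h' : ∃ b c, Arrives S L' y pos ℓ q i b c by
      obtain ⟨b, c, h'⟩ := h'
      exact ⟨b, c, h', fun h'' => absurd h'' hi⟩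
    clear hi
    induction i, hi' using Int.leInduction with
    | base =>
      refine ⟨0, 0, ?_, le_rfl, le_rfl, ?_, ?_⟩
      · rw [carrierAt_of_le (fun j hj => h.vacuum hj) le_rfl, initialCarrier_eq hℓ]
      · rw [h.left m le_rfl, hm m le_rfl]; simp
      · intro x _ _; omega
    | succ i _ ih =>
      obtain ⟨b, c, hA⟩ := ih
      obtain ⟨b', c', _, _, hA', _⟩ := arrives_succ hℓ hq h hy htop hr hA
      exact ⟨b', c', hA'⟩

/-- Site `i` now starts at `pos i - b i`, with `b i` the number of baskets that the carrier brings.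
Its baskets come from site `i - 1`, moved by one letter, or stayed in site `i` on letters that lost
their ball; in both cases the rank grows by one. -/
theorem evolve (hℓ : Fits ℓ q) (hq : 1 ≤ q) (h : Enc S L β pos m) (hL : Thin L)
    (hm : ∀ z ≤ m, y z = 0) (hy : ∀ z, 0 ≤ y z ∧ y z ≤ q) (htop : ℓ = ⊤ → ∀ z, y z < q)
    (hr : ∀ z, Rule q (cnt L z) (cnt L' z) (y z) (y (z + 1))) (hL' : ∀ s ∈ L', m ≤ s) :
    ∃ pos', Enc (T ℓ S) L' ((· + 1) '' β) pos' m := by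
  choose b c hA hb using exists_arrives hℓ hq h hm hy htop hr
  have key := fun i => arrives_succ hℓ hq h hy htop hr (hA i)
  choose b' c' d C hA' hb' hd hT hC hC' hD hw using key
  have hbb : ∀ i, b (i + 1) = b' i := fun i => by
    have := (hA (i + 1)).carrier.symm.trans (hA' i).carrier
    simp only [loaded, Carrier.mk.injEq] at this
    exact this.2.1
  have hpos : ∀ i, pos (i + 1) - b (i + 1) = pos i + max (d i) 1 := fun i => by
    rw [hbb, hb', h.succ]; ring
  have hbn := fun i => (hA i).baskets_nonneg
  refine ⟨fun i => pos i - b i, ?_, ?_, ?_, ?_, ?_, ?_, ?_, hL', ?_, ?_⟩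
  · intro i hi
    rw [hb i hi, h.left i hi, sub_zero]
  · intro i
    simp only [hpos, hT]; ring
  · intro i; simp only [hT]
  · intro i; have := hbn i; simp only [hT]; omega
  · intro i; simp only [hT]; exact hC i
  · intro i; have := hC' i; simp only [hT]; omega
  · intro i x hx hx'
    rw [hpos] at hx'
    simp only [hT]
    exact hw i x hx hx'
  · intro i x hx hx'
    rw [hpos] at hx'
    rcases le_or_gt x (pos i) with hxp | hxp
    · -- the basket comes from the previous site
      have hp := hpos (i - 1)
      have e : i - 1 + 1 = i := by ring
      rw [e] at hp
      have hin := h.rank_mem (i - 1) (x - 1) (by omega) (by rw [e]; omega)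
      have hDx := hD (i - 1) (x - 1) (by omega) (by rw [e]; omega)
      have := rank_move hq hL hy hr (x := x - 1) (by omega)
      rw [sub_add_cancel] at this
      exact ⟨this.1, _, hin.2, this.2.symm⟩
    · have hdi := hd i
      have hs := h.succ i
      have hin := h.rank_mem i x hxp (by omega)
      have hDx := (hD i x hxp.le (by omega)).mpr (by omega)
      have := rank_stay hr hin.1 hDx.1 hDx.2
      exact ⟨this.1, _, hin.2, this.2.symm⟩
  · rintro _ ⟨r, hr', rfl⟩
    obtain ⟨i, x, hx, hx', rfl⟩ := h.exists_rank r hr'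
    have hDx := hD i x hx.le hx'
    have hin := h.rank_mem i x hx hx'
    by_cases hDD : cnt L x % 2 = 1 ∧ cnt L' x % 2 = 0
    · refine ⟨i, x, ?_, ?_, (rank_stay hr hin.1 hDD.1 hDD.2).2⟩
      · have := hbn i; omega
      · rw [hpos]; have := hDx.mp hDD; omega
    · refine ⟨i + 1, x + 1, ?_, ?_, (rank_move hq hL hy hr hDD).2⟩
      · simp only [hpos]
        have := mt hDx.mpr hDD
        omega
      · rw [hpos]
        omega

end Enc

/-! ### Conservation of ones, and iteration -/

/-- The word with the change positions `L` contains at most `K` ones. -/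
def AtMostOnes (K : ℤ) (L : List ℤ) : Prop :=
  ∃ W : ℤ → ℤ, (∃ m, ∀ z ≤ m, W z = 0) ∧ (∀ z, W (z + 1) = W z + (cnt L z % 2 : ℕ)) ∧
    ∀ z, W z ≤ K

/-- Balls are conserved: the ones of the new word before `z` together with the load at `z` are the
ones of the old word before `z`. This also bounds the load, which makes a finite `q` stand in for
infinite capacity. -/
theorem AtMostOnes.evolve {K c : ℤ} {L L' : List ℤ} {y : ℤ → ℤ} (h : AtMostOnes K L)
    {m : ℤ} (hm : ∀ z ≤ m, y z = 0) (hy : ∀ z, 0 ≤ y z)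
    (hr : ∀ z, Rule c (cnt L z) (cnt L' z) (y z) (y (z + 1))) :
    AtMostOnes K L' ∧ ∀ z, y z ≤ K := by
  obtain ⟨W, ⟨m', hm'⟩, hW, hK⟩ := h
  have h1 : ∀ z, W (z + 1) - y (z + 1) = W z - y z + (cnt L' z % 2 : ℕ) := fun z => by
    have h2 := hr z
    have h3 := hW z
    unfold Rule at h2
    omega
  have h0 : ∀ z ≤ min m m', W z - y z = 0 := fun z hz => by
    rw [hm z (by omega), hm' z (by omega), sub_zero]
  refine ⟨⟨fun z => W z - y z, ⟨min m m', h0⟩, h1, fun z => ?_⟩, fun z => ?_⟩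
  · have := hK z; have := hy z; simp only; omega
  · have : 0 ≤ W z - y z := by
      by_cases hz : z ≤ min m m'
      · rw [h0 z hz]
      · have hz' : min m m' ≤ z := by omega
        clear hz
        induction z, hz' using Int.leInduction with
        | base => rw [h0 _ le_rfl]
        | succ z _ ih => have := h1 z; omega
    have := hK z
    omega

/-- An even number of changes means that the word ends in zeros, so all ones lie between the first
and the last change. -/
theorem exists_atMostOnes {L : List ℤ} (hL : L.Pairwise (· ≤ ·)) (he : L.length % 2 = 0) :
    ∃ K, AtMostOnes K L := by
  obtain ⟨lo, hlo⟩ : ∃ lo, ∀ s ∈ L, lo ≤ s := by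
    cases L with
    | nil => exact ⟨0, by simp⟩
    | cons s L =>
      refine ⟨s, fun t ht => ?_⟩
      rcases List.mem_cons.mp ht with rfl | ht
      · rfl
      · exact (List.pairwise_cons.mp hL).1 t ht
  obtain ⟨hi, hhi⟩ : ∃ hi, ∀ s ∈ L, s ≤ hi := by
    clear hL he hlo
    induction L with
    | nil => exact ⟨0, by simp⟩
    | cons s L ih =>
      obtain ⟨hi, h⟩ := ih
      refine ⟨max s hi, fun t ht => ?_⟩
      rcases List.mem_cons.mp ht with rfl | ht
      · omega
      · have := h t ht; omega
  refine ⟨max (hi - lo) 0,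
    fun z => (((Finset.Ico lo z).filter fun x => cnt L x % 2 = 1).card : ℤ), ⟨lo, fun z hz => ?_⟩,
    fun z => ?_, fun z => ?_⟩
  · simp [Finset.Ico_eq_empty (not_lt.mpr hz)]
  · by_cases hz : lo ≤ z
    · have hI : Finset.Ico lo (z + 1) = insert z (Finset.Ico lo z) := by
        ext x; simp only [Finset.mem_Ico, Finset.mem_insert]; omega
      beta_reduce
      rw [hI, Finset.filter_insert]
      split_ifs with h
      · rw [Finset.card_insert_of_notMem (by simp), h]; simp
      · have : cnt L z % 2 = 0 := by omega
        rw [this]; simp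
    · have : cnt L z = 0 := cnt_eq_zero fun s hs => by have := hlo s hs; omega
      beta_reduce
      rw [this, Finset.Ico_eq_empty (by omega), Finset.Ico_eq_empty (by omega)]
      simp
  · have hsub : ((Finset.Ico lo z).filter fun x => cnt L x % 2 = 1) ⊆ Finset.Ico lo hi := by
      intro x hx
      simp only [Finset.mem_filter, Finset.mem_Ico] at hx ⊢
      refine ⟨hx.1.1, ?_⟩
      by_contra hge
      have : cnt L x = L.length := by
        rw [cnt, List.countP_eq_length]
        intro s hs; have := hhi s hs; simp; omega
      omega
    have := Finset.card_le_card hsub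
    rw [Int.card_Ico] at this
    beta_reduce
    omega

theorem Enc.evolve_flow {S : State} {L : List ℤ} {β : Set ℤ} {pos : ℤ → ℤ} {m : ℤ} {ℓ : ℕ∞} {q : ℤ}
    (hℓ : Fits ℓ q) (hq : 1 ≤ q) (h : Enc S L β pos m) (hL : Thin L) (hs : L.Pairwise (· ≤ ·))
    (htop : ℓ = ⊤ → AtMostOnes (q - 1) L) :
    (∃ pos', Enc (T ℓ S) (flow q 0 L) ((· + 1) '' β) pos' m) ∧ Thin (flow q 0 L) ∧
      (flow q 0 L).Pairwise (· ≤ ·) ∧ (ℓ = ⊤ → AtMostOnes (q - 1) (flow q 0 L)) := by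
  obtain ⟨y, h1, h2, h3⟩ := exists_rule_flow (by omega : 0 ≤ q) hs h.le_changes
  refine ⟨h.evolve hℓ hq hL h1 h2 ?_ h3 ?_, thin_of_rule hL h2 h3,
    pairwise_flow _ _ _ (by omega) le_rfl hs, fun ht => ?_⟩
  · intro ht z
    have := ((htop ht).evolve h1 (fun z => (h2 z).1) h3).2 z
    omega
  · intro t ht
    cases L with
    | nil => simp [flow] at ht
    | cons s l =>
      have := le_of_mem_flow l _ _ s (by omega) le_rfl hs t ht
      have := h.le_changes s (by simp)
      omega
  · exact ((htop ht).evolve h1 (fun z => (h2 z).1) h3).1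

theorem Enc.iterate {S : State} {L : List ℤ} {β : Set ℤ} {pos : ℤ → ℤ} {m : ℤ} {ℓ : ℕ∞} {q : ℤ}
    (hℓ : Fits ℓ q) (hq : 1 ≤ q) (h : Enc S L β pos m) (hL : Thin L) (hs : L.Pairwise (· ≤ ·))
    (htop : ℓ = ⊤ → AtMostOnes (q - 1) L) (N : ℕ) :
    (∃ pos', Enc ((T ℓ)^[N] S) ((flow q 0)^[N] L) ((· + (N : ℤ)) '' β) pos' m) ∧
      Thin ((flow q 0)^[N] L) := by
  suffices H : (∃ pos', Enc ((T ℓ)^[N] S) ((flow q 0)^[N] L) ((· + (N : ℤ)) '' β) pos' m) ∧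
      Thin ((flow q 0)^[N] L) ∧ ((flow q 0)^[N] L).Pairwise (· ≤ ·) ∧
      (ℓ = ⊤ → AtMostOnes (q - 1) ((flow q 0)^[N] L)) from ⟨H.1, H.2.1⟩
  induction N with
  | zero => exact ⟨⟨pos, by simpa using h⟩, hL, hs, htop⟩
  | succ N ih =>
    obtain ⟨⟨pos', h1⟩, h2, h3, h4⟩ := ih
    simp only [Function.iterate_succ_apply']
    have := h1.evolve_flow hℓ hq h2 h3 h4
    rw [Set.image_image] at this
    have e : ∀ x : ℤ, x + (N : ℤ) + 1 = x + ((N + 1 : ℕ) : ℤ) := fun x => by push_cast; ring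
    simpa only [e] using this

/-! ### Encoding of explicit strings of sites -/

/-- A site with at most one ball. -/
def SimpleSite (s : Site) : Prop := 0 ≤ s.b ∧ (s.c = 0 ∨ s.c = 1) ∧ s.a = s.b - s.c + 1

/-- The change positions of the word of a list of sites which starts at position `P`, after a
ball if `prev`. -/
def changes (prev : Bool) (P : ℤ) : List Site → List ℤ
  | [] => if prev then [P] else []
  | s :: l => (if decide (s.c = 1) = prev then [] else [P]) ++
      ((if s.c = 1 ∧ s.b ≠ 0 then [P + 1] else []) ++
        changes (decide (s.c = 1 ∧ s.b = 0)) (P + s.b + 1) l)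

/-- The ranks of the baskets of a list of sites, if the first site has rank `Q`. -/
def ranks (prev : Bool) (Q : ℤ) : List Site → Set ℤ
  | [] => ∅
  | s :: l =>
      Set.Ico (if s.c = 1 ∧ prev = false then Q else Q + 1)
        ((if s.c = 1 ∧ prev = false then Q else Q + 1) + s.b) ∪
      ranks (decide (s.c = 1 ∧ s.b = 0)) ((if s.c = 1 ∧ prev = false then Q else Q + 1) + s.b) l

theorem le_of_mem_changes (l : List Site) (hl : ∀ s ∈ l, SimpleSite s) : ∀ prev P,
    ∀ t ∈ changes prev P l, P ≤ t := by
  induction l with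
  | nil => intro prev P t ht; cases prev <;> simp [changes] at ht; omega
  | cons s l ih =>
    intro prev P t ht
    have hs := (hl s (by simp)).1
    simp only [changes, List.mem_append] at ht
    rcases ht with ht | ht | ht
    · split_ifs at ht <;> simp at ht; omega
    · split_ifs at ht <;> simp at ht; omega
    · have := ih (fun s hs => hl s (by simp [hs])) _ _ t ht; omega

/-- The position of the `i`-th site of a state whose sites left of `p` contain no baskets. -/
noncomputable def sitePos (p : ℤ) (S : State) (i : ℤ) : ℤ := i + ∑ j ∈ Finset.Ico p i, (S j).b

theorem sitePos_succ {p : ℤ} {S : State} (hS : ∀ i < p, S i = V) (i : ℤ) :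
    sitePos p S (i + 1) = sitePos p S i + (S i).b + 1 := by
  unfold sitePos
  by_cases h : p ≤ i
  · have hI : Finset.Ico p (i + 1) = insert i (Finset.Ico p i) := by
      ext x; simp only [Finset.mem_Ico, Finset.mem_insert]; omega
    rw [hI, Finset.sum_insert (by simp)]; ring
  · rw [Finset.Ico_eq_empty (by omega), Finset.Ico_eq_empty (by omega), hS i (by omega)]
    simp [V]

theorem sitePos_of_le {p : ℤ} {S : State} {i : ℤ} (h : i ≤ p) : sitePos p S i = i := by
  rw [sitePos, Finset.Ico_eq_empty (by omega)]; simp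

theorem place_of_lt {p i : ℤ} {l : List Site} (h : i < p) : place p l i = V := by
  rw [place, if_neg (by omega)]

theorem place_cons_self (p : ℤ) (s : Site) (l : List Site) : place p (s :: l) p = s := by
  simp [place]

theorem place_cons {p i : ℤ} {s : Site} {l : List Site} (h : p < i) :
    place p (s :: l) i = place (p + 1) l i := by
  have e : (i - p).toNat = (i - (p + 1)).toNat + 1 := by omega
  rw [place, place, if_pos h.le, if_pos (by omega), e, List.getD_cons_succ]

theorem place_nil (p i : ℤ) : place p [] i = V := by
  simp [place]

/-- The induction scans the sites from the left. It remembers the number `k` of changes before `pos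
p`, the last letter `prev` (the parity of `k`), and `Q`, the rank that `pos p` has unless a run
begins there. A box that begins a run uses up no rank, so its first basket gets rank `Q` instead of
`Q + 1`. -/
theorem enc_place_aux (K : List ℤ) (S : State) (pos : ℤ → ℤ)
    (hpos : ∀ i, pos (i + 1) = pos i + (S i).b + 1) (l : List Site) :
    ∀ (p : ℤ) (prev : Bool) (Q : ℤ) (k : ℕ), (∀ s ∈ l, SimpleSite s) →
    (∀ i, p ≤ i → S i = place p l i) →
    (∀ x, pos p ≤ x → cnt K x = k + cnt (changes prev (pos p) l) x) →
    cnt K (pos p - 1) = k →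
    (if prev then k % 2 = 1 else k % 2 = 0) →
    Q = pos p - ((k + 1) / 2 : ℕ) →
    (∀ i, p ≤ i → (∀ x, pos i ≤ x → x < pos (i + 1) →
      (cnt K x % 2 = 1 ↔ x < pos i + (S i).c)) ∧
      (∀ x, pos i < x → x < pos (i + 1) → ¬ Asc K x ∧ rank K x ∈ ranks prev Q l)) ∧
    (∀ b ∈ ranks prev Q l, ∃ i x, pos i < x ∧ x < pos (i + 1) ∧ rank K x = b) := by
  induction l with
  | nil =>
    intro p prev Q k _ hS hK hK' hk hQ
    refine ⟨fun i hi => ?_, by simp [ranks]⟩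
    have hSi : S i = V := by rw [hS i hi, place_nil]
    have h1 := hpos i
    rw [hSi] at h1 ⊢
    have hp : pos p ≤ pos i := by
      clear hSi h1
      induction i, hi using Int.leInduction with
      | base => rfl
      | succ i hi ih => 
        have := hpos i; rw [hS i hi, place_nil] at this; simp only [V] at this; omega
    simp only [V] at h1 ⊢
    refine ⟨fun x hx hx' => ?_, fun x hx hx' => by omega⟩
    have := hK x (by omega)
    cases prev
    · simp [changes, cnt] at this hk; unfold cnt; omega
    · simp only [changes, if_true, cnt_cons, if_pos (hp.trans hx)] at this hk
      have e : cnt [] x = 0 := rfl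
      omega
  | cons s l ih =>
    intro p prev Q k hl hS hK hK' hk hQ
    obtain ⟨hsb, hsc, hsa⟩ := hl s (by simp)
    have hSp : S p = s := by rw [hS p le_rfl, place_cons_self]
    have hpp := hpos p
    rw [hSp] at hpp
    have hge := le_of_mem_changes l (fun t ht => hl t (by simp [ht]))
      (decide (s.c = 1 ∧ s.b = 0)) (pos p + s.b + 1)
    have hzero : ∀ x, x < pos p + s.b + 1 →
        cnt (changes (decide (s.c = 1 ∧ s.b = 0)) (pos p + s.b + 1) l) x = 0 := fun x hx =>
      cnt_eq_zero fun t ht => by have := hge t ht; omega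
    have happ : ∀ (l₁ l₂ : List ℤ) (x : ℤ), cnt (l₁ ++ l₂) x = cnt l₁ x + cnt l₂ x :=
      fun l₁ l₂ x => List.countP_append
    have hnil : ∀ x, cnt [] x = 0 := fun _ => rfl
    obtain ⟨g, hg⟩ : ∃ g, g = changes (decide (s.c = 1 ∧ s.b = 0)) (pos p + s.b + 1) l := ⟨_, rfl⟩
    rw [← hg] at hzero
    -- the count behind the box and behind the baskets of the first site
    obtain ⟨k₁, hk₁⟩ : ∃ k₁, k₁ = k + (if decide (s.c = 1) = prev then 0 else 1) := ⟨_, rfl⟩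
    obtain ⟨k₂, hk₂⟩ : ∃ k₂, k₂ = k₁ + (if s.c = 1 ∧ s.b ≠ 0 then 1 else 0) := ⟨_, rfl⟩
    have hcnt : ∀ x, pos p ≤ x → cnt K x =
        k₁ + (if s.c = 1 ∧ s.b ≠ 0 ∧ pos p + 1 ≤ x then 1 else 0) + cnt g x := fun x hx => by
      rw [hK x hx, changes, happ, happ, ← hg, hk₁]
      have e1 : cnt (if decide (s.c = 1) = prev then [] else [pos p]) x =
          if decide (s.c = 1) = prev then 0 else 1 := by
        split_ifs <;> simp [cnt_cons, hnil, hx]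
      have e2 : cnt (if s.c = 1 ∧ s.b ≠ 0 then [pos p + 1] else []) x =
          if s.c = 1 ∧ s.b ≠ 0 ∧ pos p + 1 ≤ x then 1 else 0 := by
        by_cases h1 : s.c = 1 ∧ s.b ≠ 0
        · simp [h1, cnt_cons, hnil]
        · rw [if_neg h1, if_neg fun h => h1 ⟨h.1, h.2.1⟩, hnil]
      rw [e1, e2]; ring
    have hk1 : (s.c = 1 ↔ k₁ % 2 = 1) := by
      cases prev <;> rcases hsc with h0 | h0 <;> simp [h0] at hk hk₁ ⊢ <;> omega
    have hbox : cnt K (pos p) = k₁ := by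
      rw [hcnt _ le_rfl, if_neg (by omega), hzero _ (by omega)]; rfl
    have hbask : ∀ x, pos p < x → x < pos p + s.b + 1 → cnt K x = k₂ := fun x hx hx' => by
      rw [hcnt x hx.le, hzero x hx', hk₂]
      have : (s.c = 1 ∧ s.b ≠ 0 ∧ pos p + 1 ≤ x) ↔ (s.c = 1 ∧ s.b ≠ 0) := by
        constructor
        · exact fun h => ⟨h.1, h.2.1⟩
        · exact fun h => ⟨h.1, h.2, by omega⟩
      simp only [this, add_zero]
    have hk2 : 0 < s.b → k₂ % 2 = 0 := fun hb => by
      rw [hk₂]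
      rcases hsc with h0 | h0
      · simp [h0] at hk1 ⊢; omega
      · simp [h0, hb.ne'] at hk1 ⊢; omega
    obtain ⟨Q₁, hQ₁⟩ : ∃ Q₁, Q₁ = if s.c = 1 ∧ prev = false then Q else Q + 1 := ⟨_, rfl⟩
    have hQ1 : Q₁ = pos p + 1 - ((k₂ + 1) / 2 : ℕ) := by
      rw [hQ₁]
      cases prev <;> rcases hsc with h0 | h0 <;> by_cases hb : s.b = 0 <;>
        simp [h0, hb] at hk hk₁ hk₂ ⊢ <;> omega
    have ih' := ih (p + 1) (decide (s.c = 1 ∧ s.b = 0)) (Q₁ + s.b) k₂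
      (fun t ht => hl t (by simp [ht]))
      (fun i hi => by rw [hS i (by omega), place_cons (by omega)])
      (fun x hx => by
        rw [hpp] at hx ⊢
        rw [hcnt x (by omega), ← hg, hk₂]
        have : (s.c = 1 ∧ s.b ≠ 0 ∧ pos p + 1 ≤ x) ↔ (s.c = 1 ∧ s.b ≠ 0) := by
          constructor
          · exact fun h => ⟨h.1, h.2.1⟩
          · exact fun h => ⟨h.1, h.2, by omega⟩
        simp only [this])
      (by
        rw [hpp, add_sub_cancel_right]
        by_cases hb : s.b = 0
        · rw [hb, add_zero, hbox, hk₂]; simp [hb]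
        · exact hbask _ (by omega) (by omega))
      (by
        by_cases hb : s.b = 0
        · rcases hsc with h0 | h0 <;> simp [h0, hb] at hk1 hk₂ ⊢ <;> omega
        · simp [hb]; exact hk2 (by omega))
      (by rw [hpp, hQ1]; ring)
    rw [ranks, ← hQ₁]
    refine ⟨fun i hi => ?_, ?_⟩
    · rcases hi.eq_or_lt with rfl | hi
      · rw [hpp, hSp]
        refine ⟨fun x hx hx' => ?_, fun x hx hx' => ⟨?_, Or.inl ?_⟩⟩
        · rcases hx.eq_or_lt with rfl | hx
          · rw [hbox]; omega
          · rw [hbask x hx (by omega)]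
            have := hk2 (by omega)
            omega
        · have := hk2 (by omega)
          rw [Asc, hbask x hx (by omega)]; omega
        · rw [rank, hbask x hx (by omega), Set.mem_Ico, hQ1]; omega
      · have := ih'.1 i (by omega)
        exact ⟨this.1, fun x hx hx' => ⟨(this.2 x hx hx').1, Or.inr (this.2 x hx hx').2⟩⟩
    · rintro b (hb | hb)
      · rw [Set.mem_Ico] at hb
        refine ⟨p, b + (pos p + 1 - Q₁), by omega, by omega, ?_⟩
        rw [rank, hbask _ (by omega) (by omega), hQ1]; ring
      · exact ih'.2 b hb

theorem enc_place (p : ℤ) (l : List Site) (hl : ∀ s ∈ l, SimpleSite s) :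
    Enc (place p l) (changes false p l) (ranks false p l) (sitePos p (place p l)) p := by
  have hS : ∀ i < p, place p l i = V := fun i hi => place_of_lt hi
  have hpp := sitePos_of_le (S := place p l) (le_refl p)
  have hsucc := sitePos_succ hS
  have hge := le_of_mem_changes l hl false p
  have hneg : ∀ x < p, cnt (changes false p l) x = 0 := fun x hx =>
    cnt_eq_zero fun t ht => by have := hge t ht; omega
  obtain ⟨h1, h2⟩ := enc_place_aux (changes false p l) (place p l) (sitePos p (place p l)) hsucc
    l p false p 0 hl (fun _ _ => rfl) (fun x _ => by rw [hpp, zero_add])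
    (by rw [hpp]; exact hneg _ (by omega)) (by simp) (by simp [hpp])
  have hsimple : ∀ i, SimpleSite (place p l i) := fun i => by
    unfold place
    split_ifs
    · rw [List.getD_eq_getElem?_getD]
      cases h : l[(i - p).toNat]? with
      | none => simp [SimpleSite, V]
      | some s => exact hl s (List.mem_of_getElem? h)
    · simp [SimpleSite, V]
  refine ⟨fun i hi => sitePos_of_le hi, hsucc, fun i => (hsimple i).2.2, fun i => (hsimple i).1,
    fun i => ?_, fun i => ?_, fun i x hx hx' => ?_, hge, fun i x hx hx' => ?_, h2⟩
  · have := hsimple i; unfold SimpleSite at this; omega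
  · have := hsimple i; unfold SimpleSite at this; omega
  · by_cases hi : p ≤ i
    · exact (h1 i hi).1 x hx hx'
    · have e := hsucc i
      rw [hS i (by omega)] at e ⊢
      rw [sitePos_of_le (i := i) (by omega)] at *
      simp only [V] at e ⊢
      rw [hneg x (by omega)]
      omega
  · by_cases hi : p ≤ i
    · exact (h1 i hi).2 x hx hx'
    · have e := hsucc i
      rw [hS i (by omega)] at e
      simp only [V] at e
      omega

/-! ### Existence and uniqueness of the cutting -/

/-- Put a letter in front of a string which is cut into chunks. -/
def consChunk : Letter → List Chunk → List Chunk
  | .F, cs => .VF :: cs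
  | .U b, .VU b' bs :: cs => .VU b (b' :: bs) :: cs
  | .U b, .VUF b' bs :: cs => .VUF b (b' :: bs) :: cs
  | .U b, .VF :: cs => .VUF b [] :: cs
  | .U b, cs => .VU b [] :: cs
  | .B a, .VU b bs :: cs => .BU a b bs :: cs
  | .B a, .VUF b bs :: cs => .BUF a (b :: bs) :: cs
  | .B a, .VF :: cs => .BUF a [] :: cs
  | .B a, .Bs a' as :: cs => .Bs a (a' :: as) :: cs
  | .B a, cs => .Bs a [] :: cs

/-- The cutting of a string of letters into chunks. -/
def cutting (A : List Letter) : List Chunk := A.foldr consChunk []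

theorem isCutting_of_head {c d : Chunk} {t : List Chunk} {w : List Letter} {x : Letter}
    (h : IsCutting (c :: t) (x :: w)) (hl : c.letters = x :: d.letters)
    (hr : d.IsRun → c.IsRun) : IsCutting (d :: t) w := by
  obtain ⟨h1, h2⟩ := h
  rw [List.flatMap_cons, hl, List.cons_append, List.cons.injEq] at h1
  refine ⟨h1.2, ?_⟩
  cases t with
  | nil => exact List.isChain_singleton _
  | cons e t =>
    rw [List.isChain_cons_cons] at h2 ⊢
    exact ⟨⟨h2.1.1, fun h => h2.1.2 ⟨hr h.1, h.2⟩⟩, h2.2⟩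

theorem isCutting_of_tail {c : Chunk} {t : List Chunk} {w : List Letter} {x : Letter}
    (h : IsCutting (c :: t) (x :: w)) (hl : c.letters = [x]) : IsCutting t w := by
  obtain ⟨h1, h2⟩ := h
  rw [List.flatMap_cons, hl, List.cons_append, List.cons.injEq] at h1
  exact ⟨h1.2, h2.tail⟩

theorem head_eq_of_isCutting {c : Chunk} {t : List Chunk} {w ls : List Letter} {x y : Letter}
    (h : IsCutting (c :: t) (x :: w)) (hl : c.letters = y :: ls) : y = x := by
  have := h.1
  rw [List.flatMap_cons, hl, List.cons_append, List.cons.injEq] at this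
  exact this.1

/-- Uniqueness rests on this: deleting the first letter of a cut string leaves a cut string, and the
way to put the letter back is forced. The chain condition enters only when that letter was a whole
chunk: the next chunk starts with `B`, and two runs of letters `B` may not meet. -/
theorem exists_consChunk_eq {cs : List Chunk} {x : Letter} {w : List Letter}
    (h : IsCutting cs (x :: w)) : ∃ cs', IsCutting cs' w ∧ consChunk x cs' = cs := by
  cases cs with
  | nil => simp [IsCutting] at h
  | cons c t =>
    have hd : ∀ d t', t = d :: t' → d.StartsWithB ∧ ¬ (c.IsRun ∧ d.IsRun) := fun d t' e => by
      subst e; exact (List.isChain_cons_cons.mp h.2).1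
    cases c with
    | BU a b bs =>
      obtain rfl := head_eq_of_isCutting h rfl
      exact ⟨_, isCutting_of_head (d := .VU b bs) h rfl id, rfl⟩
    | BUF a bs =>
      obtain rfl := head_eq_of_isCutting h rfl
      cases bs with
      | nil => exact ⟨_, isCutting_of_head (d := .VF) h rfl id, rfl⟩
      | cons b bs => exact ⟨_, isCutting_of_head (d := .VUF b bs) h rfl id, rfl⟩
    | VU b bs =>
      obtain rfl := head_eq_of_isCutting h rfl
      cases bs with
      | nil =>
        refine ⟨t, isCutting_of_tail h rfl, ?_⟩
        cases t with
        | nil => rfl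
        | cons d t =>
          have := (hd d t rfl).1
          cases d <;> first | rfl | exact this.elim
      | cons b' bs => exact ⟨_, isCutting_of_head (d := .VU b' bs) h rfl id, rfl⟩
    | VUF b bs =>
      obtain rfl := head_eq_of_isCutting h rfl
      cases bs with
      | nil => exact ⟨_, isCutting_of_head (d := .VF) h rfl id, rfl⟩
      | cons b' bs => exact ⟨_, isCutting_of_head (d := .VUF b' bs) h rfl id, rfl⟩
    | VF =>
      obtain rfl := head_eq_of_isCutting h rfl
      exact ⟨t, isCutting_of_tail h rfl, rfl⟩
    | Bs a as =>
      obtain rfl := head_eq_of_isCutting h rfl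
      cases as with
      | nil =>
        refine ⟨t, isCutting_of_tail h rfl, ?_⟩
        cases t with
        | nil => rfl
        | cons d t =>
          have := hd d t rfl
          cases d <;> first | rfl | exact this.1.elim | exact (this.2 ⟨trivial, trivial⟩).elim
      | cons a' as => exact ⟨_, isCutting_of_head (d := .Bs a' as) h rfl id, rfl⟩

theorem eq_cutting {A : List Letter} : ∀ {cs : List Chunk}, IsCutting cs A → cs = cutting A := by
  induction A with
  | nil =>
    intro cs h
    cases cs with
    | nil => rfl
    | cons c t => cases c <;> simp [IsCutting, Chunk.letters] at h
  | cons x A ih =>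
    intro cs h
    obtain ⟨cs', h1, h2⟩ := exists_consChunk_eq h
    rw [← h2, ih h1]; rfl

theorem isCutting_cons_of_head {c d : Chunk} {t : List Chunk} {w : List Letter} {x : Letter}
    (h : IsCutting (d :: t) w) (hl : c.letters = x :: d.letters)
    (hr : c.IsRun → d.IsRun) : IsCutting (c :: t) (x :: w) := by
  obtain ⟨h1, h2⟩ := h
  rw [List.flatMap_cons] at h1
  refine ⟨by rw [List.flatMap_cons, hl, List.cons_append, h1], ?_⟩
  cases t with
  | nil => exact List.isChain_singleton _
  | cons e t =>
    rw [List.isChain_cons_cons] at h2 ⊢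
    exact ⟨⟨h2.1.1, fun h => h2.1.2 ⟨hr h.1, h.2⟩⟩, h2.2⟩

theorem isCutting_cons_of_tail {c : Chunk} {t : List Chunk} {w : List Letter} {x : Letter}
    (h : IsCutting t w) (hl : c.letters = [x])
    (hc : ∀ d t', t = d :: t' → d.StartsWithB ∧ ¬ (c.IsRun ∧ d.IsRun)) :
    IsCutting (c :: t) (x :: w) := by
  obtain ⟨h1, h2⟩ := h
  refine ⟨by rw [List.flatMap_cons, hl, h1]; rfl, ?_⟩
  cases t with
  | nil => exact List.isChain_singleton _
  | cons e t => exact List.isChain_cons_cons.mpr ⟨hc e t rfl, h2⟩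

theorem isCutting_consChunk {cs : List Chunk} {x : Letter} {w : List Letter} (h : IsCutting cs w)
    (hx : ∀ y w', w = y :: w' → ¬ x.Forbidden y) : IsCutting (consChunk x cs) (x :: w) := by
  cases x with
  | F =>
    refine isCutting_cons_of_tail h rfl fun d t' e => ?_
    subst e
    have h1 := h.1
    rw [List.flatMap_cons] at h1
    cases d with
    | VU b bs => exact (hx _ _ h1.symm trivial).elim
    | VUF b bs => exact (hx _ _ h1.symm trivial).elim
    | VF => exact (hx _ _ h1.symm trivial).elim
    | _ => exact ⟨trivial, fun h => h.1⟩
  | U b =>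
    cases cs with
    | nil => exact isCutting_cons_of_tail h rfl (by simp)
    | cons c t =>
      cases c with
      | VU b' bs => exact isCutting_cons_of_head h rfl id
      | VUF b' bs => exact isCutting_cons_of_head h rfl id
      | VF => exact isCutting_cons_of_head h rfl id
      | _ =>
        refine isCutting_cons_of_tail h rfl fun d t' e => ?_
        cases e; exact ⟨trivial, fun h => h.1⟩
  | B a =>
    cases cs with
    | nil => exact isCutting_cons_of_tail h rfl (by simp)
    | cons c t =>
      cases c with
      | VU b' bs => exact isCutting_cons_of_head h rfl id
      | VUF b' bs => exact isCutting_cons_of_head h rfl id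
      | VF => exact isCutting_cons_of_head h rfl id
      | Bs a as => exact isCutting_cons_of_head h rfl id
      | _ =>
        refine isCutting_cons_of_tail h rfl fun d t' e => ?_
        cases e; exact ⟨trivial, fun h => h.2⟩

theorem isCutting_cutting {A : List Letter} (h : A.IsChain fun x y => ¬ x.Forbidden y) :
    IsCutting (cutting A) A := by
  induction A with
  | nil => exact ⟨rfl, List.isChain_nil⟩
  | cons x A ih =>
    refine isCutting_consChunk (ih h.tail) fun y w' e => ?_
    subst e
    exact (List.isChain_cons_cons.mp h).1

/-! ### Balls and baskets of a slow soliton -/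

/-- The positions of the balls of a string of letters which starts at `P`. -/
def balls (P : ℤ) : List Letter → List ℤ
  | [] => []
  | .F :: l => P :: balls (P + 1) l
  | .U a :: l => P :: balls (P + a + 1) l
  | .B a :: l => balls (P + a + 1) l

/-- The number of boxes and baskets of a string of letters. -/
def width : List Letter → ℕ
  | [] => 0
  | .F :: l => 1 + width l
  | .U a :: l => a + 1 + width l
  | .B a :: l => a + 1 + width l

/-- The numbers of baskets which follow the beginning and each letter `B` of a string. -/
def basketRuns : List Letter → ℕ × List ℕ
  | [] => (0, [])
  | .F :: l => basketRuns l
  | .U a :: l => (a + (basketRuns l).1, (basketRuns l).2)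
  | .B a :: l => (0, (a + (basketRuns l).1) :: (basketRuns l).2)

/-- The string does not begin with `F` or `U`. -/
def NoBallFirst : List Letter → Prop
  | .F :: _ => False
  | .U _ :: _ => False
  | _ => True

theorem noBallFirst_of_isChain {l : List Letter}
    (h : (Letter.F :: l).IsChain fun x y => ¬ x.Forbidden y) : NoBallFirst l := by
  cases l with
  | nil => trivial
  | cons y l =>
    have := (List.isChain_cons_cons.mp h).1
    cases y <;> first | trivial | exact this trivial

/-- Baskets in front of the first `B` exist only in a leading chunk $VU\cdots$, whose sum is
therefore set apart; a `B` put in front absorbs it. A leading `F` cannot be followed by such a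
chunk. -/
theorem basketRuns_cutting {A : List Letter} (hA : A.IsChain fun x y => ¬ x.Forbidden y) :
    basketRuns A = match cutting A with
      | .VU b bs :: t => ((b :: bs).sum, t.flatMap Chunk.subscripts)
      | .VUF b bs :: t => ((b :: bs).sum, t.flatMap Chunk.subscripts)
      | cs => (0, cs.flatMap Chunk.subscripts) := by
  induction A with
  | nil => rfl
  | cons x A ih =>
    have e : cutting (x :: A) = consChunk x (cutting A) := rfl
    have hcut : (cutting A).flatMap Chunk.letters = A := (isCutting_cutting hA.tail).1
    rw [e]
    cases x with
    | F =>
      have hn := noBallFirst_of_isChain hA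
      simp only [basketRuns, ih hA.tail]
      rcases hc : cutting A with _ | ⟨c, t⟩
      · rfl
      · cases c
        case VU => rw [← hcut, hc] at hn; exact False.elim hn
        case VUF => rw [← hcut, hc] at hn; exact False.elim hn
        all_goals rfl
    | _ =>
      simp only [basketRuns, ih hA.tail]
      rcases cutting A with _ | ⟨c, t⟩
      · rfl
      · cases c <;> simp [consChunk, Chunk.subscripts]

theorem length_balls_eq (A : List Letter) : ∀ P : ℤ,
    (balls P A).length = ((cutting A).map Chunk.numF).sum := by
  induction A with
  | nil => intro P; rfl
  | cons x A ih =>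
    intro P
    have e : cutting (x :: A) = consChunk x (cutting A) := rfl
    rw [e]
    cases x <;> simp only [balls, List.length_cons, ih] <;>
      rcases cutting A with _ | ⟨c, t⟩ <;>
      first
      | rfl
      | (cases c <;> simp [consChunk, Chunk.numF] <;> ring)

/-- The ranks of the baskets of a string `B_{c_1} … B_{c_s}` which starts at rank `Q`. -/
def runRanks (Q : ℤ) : List ℕ → Set ℤ
  | [] => ∅
  | c :: cs => Set.Ico (Q + 1) (Q + 1 + c) ∪ runRanks (Q + 1 + c) cs

theorem image_add_runRanks (N : ℤ) (cs : List ℕ) : ∀ Q : ℤ,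
    (· + N) '' runRanks Q cs = runRanks (Q + N) cs := by
  induction cs with
  | nil => simp [runRanks]
  | cons c cs ih =>
    intro Q
    rw [runRanks, runRanks, Set.image_union, ih, Set.image_add_const_Ico]
    congr 2 <;> ring

/-- A nonempty group of baskets before the first `B` has no empty box of its own. The vacuum in
front serves as one, and then `δ = 1`. -/
theorem exists_runRanks_eq {A : List Letter} (hA : A.IsChain fun x y => ¬ x.Forbidden y) : ∃ δ : ℤ, 0 ≤ δ ∧ δ ≤ 1 ∧ ∀ Q : ℤ,
    Set.Ico Q (Q + (basketRuns A).1) ∪ runRanks (Q + (basketRuns A).1) (basketRuns A).2 =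
      runRanks (Q - δ) ((cutting A).flatMap Chunk.subscripts) := by
  rw [basketRuns_cutting hA]
  split
  · refine ⟨1, by simp, le_rfl, fun Q => ?_⟩
    rename_i h
    rw [h]; simp [Chunk.subscripts, runRanks]
  · refine ⟨1, by simp, le_rfl, fun Q => ?_⟩
    rename_i h
    rw [h]; simp [Chunk.subscripts, runRanks]
  · exact ⟨0, le_rfl, by simp, fun Q => by simp⟩

theorem changes_vacuum (prev : Bool) (P : ℤ) (g : ℕ) :
    changes prev P (List.replicate g V) = if prev then [P] else [] := by
  induction g generalizing prev P with
  | zero => rfl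
  | succ g ih => cases prev <;> simp [List.replicate_succ, changes, V] at ih ⊢ <;> simp [ih]

theorem ranks_vacuum (prev : Bool) (Q : ℤ) (g : ℕ) : ranks prev Q (List.replicate g V) = ∅ := by
  induction g generalizing prev Q with
  | zero => rfl
  | succ g ih => simp [List.replicate_succ, ranks, V] at ih ⊢; simp [ih]

/-- Because `FF` and `FU` are excluded and a `U` has a basket, no two ones are adjacent: each ball
is a run by itself. -/
theorem changes_letters (g : ℕ) (A : List Letter) : ∀ (prev : Bool) (P : ℤ),
    (∀ x ∈ A, x.Proper) → (A.IsChain fun x y => ¬ x.Forbidden y) → (prev = true → NoBallFirst A) →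
    changes prev P (A.map Letter.site ++ List.replicate g V) =
      (if prev then [P] else []) ++ (balls P A).flatMap fun y => [y, y + 1] := by
  induction A with
  | nil => intro prev P _ _ _; simp [balls, changes_vacuum]
  | cons x A ih =>
    intro prev P hp hc hn
    have hp' : ∀ x ∈ A, x.Proper := fun y hy => hp y (by simp [hy])
    have hx := hp x (by simp)
    cases x with
    | F =>
      have := ih true (P + 1) hp' hc.tail fun _ => noBallFirst_of_isChain hc
      cases prev
      · simp [changes, Letter.site, balls, this]
      · exact (hn rfl).elim
    | U a =>
      have := ih false (P + a + 1) hp' hc.tail (by simp)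
      have ha : a ≠ 0 := by simp only [Letter.Proper] at hx; omega
      cases prev
      · simp [changes, Letter.site, balls, this, ha]
      · exact (hn rfl).elim
    | B a =>
      have := ih false (P + a + 1) hp' hc.tail (by simp)
      cases prev <;> simp [changes, Letter.site, balls, this]

/-- Since each ball begins a run, the boxes of `F` and `U` use no rank. The baskets of a `U`
continue the preceding interval of ranks, and only a `B` opens a new one. -/
theorem ranks_letters (g : ℕ) (A : List Letter) : ∀ (prev : Bool) (Q : ℤ),
    (∀ x ∈ A, x.Proper) → (A.IsChain fun x y => ¬ x.Forbidden y) → (prev = true → NoBallFirst A) →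
    ranks prev Q (A.map Letter.site ++ List.replicate g V) =
      Set.Ico Q (Q + (basketRuns A).1) ∪ runRanks (Q + (basketRuns A).1) (basketRuns A).2 := by
  induction A with
  | nil => intro prev Q _ _ _; simp [basketRuns, ranks_vacuum, runRanks]
  | cons x A ih =>
    intro prev Q hp hc hn
    have hp' : ∀ x ∈ A, x.Proper := fun y hy => hp y (by simp [hy])
    have hx := hp x (by simp)
    cases x with
    | F =>
      have := ih true Q hp' hc.tail fun _ => noBallFirst_of_isChain hc
      cases prev
      · simp [ranks, Letter.site, basketRuns, this]
      · exact (hn rfl).elim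
    | U a =>
      have := ih false (Q + a) hp' hc.tail (by simp)
      have ha : a ≠ 0 := by simp only [Letter.Proper] at hx; omega
      cases prev
      · simp only [List.map_cons, List.cons_append, ranks, Letter.site, basketRuns]
        simp only [and_self, if_true, Nat.cast_eq_zero, ha, and_false, decide_false, this,
          Nat.cast_add, ← Set.union_assoc, ← add_assoc]
        rw [Set.Ico_union_Ico_eq_Ico (by omega) (by omega)]
      · exact (hn rfl).elim
    | B a =>
      have := ih false (Q + 1 + a) hp' hc.tail (by simp)
      simp only [List.map_cons, List.cons_append, ranks, Letter.site, basketRuns, runRanks]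
      simp only [zero_ne_one, false_and, if_false, decide_false, this,
          Nat.cast_add, ← Set.union_assoc, ← add_assoc]
      rw [Set.Ico_union_Ico_eq_Ico (by omega) (by omega)]
      simp

theorem balls_bounds (A : List Letter) : ∀ P : ℤ, ∀ y ∈ balls P A, P ≤ y ∧ y ≤ P + width A := by
  induction A with
  | nil => simp [balls]
  | cons x A ih =>
    intro P y hy
    cases x <;> simp only [balls, width, List.mem_cons] at hy ⊢
    · rcases hy with rfl | hy
      · omega
      · have := ih _ y hy; push_cast; omega
    · have := ih _ y hy; push_cast; omega
    · rcases hy with rfl | hy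
      · omega
      · have := ih _ y hy; push_cast; omega

theorem isChain_balls (A : List Letter) : ∀ P : ℤ, (∀ x ∈ A, x.Proper) →
    (A.IsChain fun x y => ¬ x.Forbidden y) → (balls P A).IsChain fun y y' => y + 2 ≤ y' := by
  induction A with
  | nil => intros; exact List.isChain_nil
  | cons x A ih =>
    intro P hp hc
    have hp' : ∀ x ∈ A, x.Proper := fun y hy => hp y (by simp [hy])
    have hx := hp x (by simp)
    have key : ∀ P' : ℤ, (∀ y ∈ balls P' A, P + 2 ≤ y) →
        (P :: balls P' A).IsChain fun y y' => y + 2 ≤ y' := fun P' hP => by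
      have h1 := ih P' hp' hc.tail
      cases h : balls P' A with
      | nil => exact List.isChain_singleton _
      | cons y l => rw [h] at h1 hP; exact List.isChain_cons_cons.mpr ⟨hP y (by simp), h1⟩
    cases x with
    | F =>
      refine key (P + 1) fun y hy => ?_
      have hn := noBallFirst_of_isChain hc
      cases A with
      | nil => simp [balls] at hy
      | cons z A =>
        cases z with
        | F => exact hn.elim
        | U a => exact hn.elim
        | B a => have := balls_bounds A _ y hy; omega
    | U a =>
      refine key (P + a + 1) fun y hy => ?_
      have := balls_bounds A _ y hy
      simp only [Letter.Proper] at hx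
      omega
    | B a => exact ih _ hp' hc.tail

/-! ### Words and ranks of blocks and of strings of letters `B` -/

/-- The sites of `k` letters `F` followed by `g` vacuum sites, for `b = (k, g)`. -/
def blockSites (b : ℕ × ℕ) : List Site := List.replicate b.1 Letter.F.site ++ List.replicate b.2 V

/-- The number of sites of a list of blocks. -/
def blocksLength (l : List (ℕ × ℕ)) : ℕ := (l.map fun b => b.1 + b.2).sum

theorem changes_F_cons (prev : Bool) (P : ℤ) (l : List Site) :
    changes prev P (Letter.F.site :: l) = (if prev then [] else [P]) ++ changes true (P + 1) l := by
  cases prev <;> simp [changes, Letter.site]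

theorem changes_V_cons (prev : Bool) (P : ℤ) (l : List Site) :
    changes prev P (V :: l) = (if prev then [P] else []) ++ changes false (P + 1) l := by
  cases prev <;> simp [changes, V]

theorem ranks_F_cons (prev : Bool) (Q : ℤ) (l : List Site) :
    ranks prev Q (Letter.F.site :: l) = ranks true (if prev then Q + 1 else Q) l := by
  cases prev <;> simp [ranks, Letter.site]

theorem ranks_V_cons (prev : Bool) (Q : ℤ) (l : List Site) :
    ranks prev Q (V :: l) = ranks false (Q + 1) l := by
  simp [ranks, V]

theorem changes_replicate_F (k : ℕ) (l : List Site) : ∀ P : ℤ,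
    changes true P (List.replicate k Letter.F.site ++ l) = changes true (P + k) l := by
  induction k with
  | zero => simp
  | succ k ih =>
    intro P
    rw [List.replicate_succ, List.cons_append, changes_F_cons, ih, if_pos rfl, List.nil_append]
    congr 1; push_cast; ring

theorem ranks_replicate_F (k : ℕ) (l : List Site) : ∀ Q : ℤ,
    ranks true Q (List.replicate k Letter.F.site ++ l) = ranks true (Q + k) l := by
  induction k with
  | zero => simp
  | succ k ih =>
    intro Q
    rw [List.replicate_succ, List.cons_append, ranks_F_cons, ih, if_pos rfl]
    congr 1; push_cast; ring

theorem changes_replicate_V (g : ℕ) (l : List Site) : ∀ P : ℤ,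
    changes false P (List.replicate g V ++ l) = changes false (P + g) l := by
  induction g with
  | zero => simp
  | succ g ih =>
    intro P
    rw [List.replicate_succ, List.cons_append, changes_V_cons, ih, if_neg (by simp),
      List.nil_append]
    congr 1; push_cast; ring

theorem ranks_replicate_V (g : ℕ) (l : List Site) : ∀ Q : ℤ,
    ranks false Q (List.replicate g V ++ l) = ranks false (Q + g) l := by
  induction g with
  | zero => simp
  | succ g ih =>
    intro Q
    rw [List.replicate_succ, List.cons_append, ranks_V_cons, ih]
    congr 1; push_cast; ring

theorem changes_blocks (bl : List (ℕ × ℕ)) (h : ∀ b ∈ bl, 1 ≤ b.1 ∧ 1 ≤ b.2) (l : List Site) :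
    ∀ P : ℤ, changes false P (bl.flatMap blockSites ++ l) =
      sw P bl ++ changes false (P + blocksLength bl) l := by
  induction bl with
  | nil => simp [sw, blocksLength]
  | cons b bl ih =>
    intro P
    obtain ⟨k, g⟩ := b
    have hb := h _ (by simp : (k, g) ∈ (k, g) :: bl)
    obtain ⟨k, rfl⟩ : ∃ k', k = k' + 1 := ⟨k - 1, by simp only at hb; omega⟩
    obtain ⟨g, rfl⟩ : ∃ g', g = g' + 1 := ⟨g - 1, by simp only at hb; omega⟩
    have e1 : P + 1 + (k : ℤ) + 1 + g = P + ((k + 1 : ℕ) : ℤ) + ((g + 1 : ℕ) : ℤ) := by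
      push_cast; ring
    have e2 : P + (blocksLength ((k + 1, g + 1) :: bl) : ℤ) =
        P + ((k + 1 : ℕ) : ℤ) + ((g + 1 : ℕ) : ℤ) + blocksLength bl := by
      simp only [blocksLength, List.map_cons, List.sum_cons]; push_cast; ring
    have e3 : P + 1 + (k : ℤ) = P + ((k + 1 : ℕ) : ℤ) := by push_cast; ring
    rw [List.flatMap_cons, blockSites, List.append_assoc, List.append_assoc, List.replicate_succ,
      List.cons_append, changes_F_cons, changes_replicate_F, List.replicate_succ,
      List.cons_append, changes_V_cons, changes_replicate_V, e1,
      ih (fun c hc => h c (by simp [hc])), sw, e2, e3]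
    simp

theorem ranks_blocks (bl : List (ℕ × ℕ)) (h : ∀ b ∈ bl, 1 ≤ b.1 ∧ 1 ≤ b.2) (l : List Site) :
    ∀ Q : ℤ, ranks false Q (bl.flatMap blockSites ++ l) =
      ranks false (Q + blocksLength bl - bl.length) l := by
  induction bl with
  | nil => simp [blocksLength]
  | cons b bl ih =>
    intro Q
    obtain ⟨k, g⟩ := b
    have hb := h _ (by simp : (k, g) ∈ (k, g) :: bl)
    obtain ⟨k, rfl⟩ : ∃ k', k = k' + 1 := ⟨k - 1, by simp only at hb; omega⟩
    obtain ⟨g, rfl⟩ : ∃ g', g = g' + 1 := ⟨g - 1, by simp only at hb; omega⟩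
    rw [List.flatMap_cons, blockSites, List.append_assoc, List.append_assoc, List.replicate_succ,
      List.cons_append, ranks_F_cons, ranks_replicate_F, List.replicate_succ,
      List.cons_append, ranks_V_cons, ranks_replicate_V, ih (fun c hc => h c (by simp [hc]))]
    congr 1
    simp [blocksLength]; ring

theorem changes_pureB (cs : List ℕ) (l : List Site) : ∀ P : ℤ,
    changes false P ((cs.map fun c => (Letter.B c).site) ++ l) =
      changes false (P + ((cs.map (· + 1)).sum : ℕ)) l := by
  induction cs with
  | nil => simp
  | cons c cs ih =>
    intro P
    have e : ∀ r, changes false P ((Letter.B c).site :: r) = changes false (P + c + 1) r := fun r => by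
      simp [changes, Letter.site]
    rw [List.map_cons, List.cons_append, e, ih]
    congr 1; simp; ring

theorem ranks_pureB (cs : List ℕ) (l : List Site) : ∀ Q : ℤ,
    ranks false Q ((cs.map fun c => (Letter.B c).site) ++ l) =
      runRanks Q cs ∪ ranks false (Q + ((cs.map (· + 1)).sum : ℕ)) l := by
  induction cs with
  | nil => simp [runRanks]
  | cons c cs ih =>
    intro Q
    have e : ∀ r, ranks false Q ((Letter.B c).site :: r) =
        Set.Ico (Q + 1) (Q + 1 + c) ∪ ranks false (Q + 1 + c) r := fun r => by
      simp [ranks, Letter.site]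
    rw [List.map_cons, List.cons_append, e, ih, runRanks, Set.union_assoc]
    congr 3; simp; ring

/-! ### Fast solitons overtaking a slow one -/

/-- Subtract `z, z + 2, z + 4, …` from the entries of a list. -/
def shrink (z : ℤ) : List ℤ → List ℤ
  | [] => []
  | y :: l => (y - z) :: shrink (z + 2) l

theorem length_shrink (l : List ℤ) : ∀ z, (shrink z l).length = l.length := by
  induction l with
  | nil => intro; rfl
  | cons y l ih => intro z; simp [shrink, ih]

/-- Each pair counts for two entries in `stretch`, which cancels the increment of `shrink`; only the
difference of the starting values survives, as a rigid shift of all balls. -/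
theorem stretch_flatMap_shrink (l : List ℤ) : ∀ z w : ℤ,
    stretch z ((shrink w l).flatMap fun f => [f, f]) =
      (l.map (· + (z - w))).flatMap fun y => [y, y + 1] := by
  induction l with
  | nil => intros; rfl
  | cons y l ih =>
    intro z w
    simp only [shrink, List.flatMap_cons, List.cons_append, List.nil_append, stretch, ih,
      List.map_cons]
    congr 1
    · ring
    · congr 1
      · ring
      · congr 2; funext; ring

theorem stretch_append (l₁ l₂ : List ℤ) : ∀ z : ℤ,
    stretch z (l₁ ++ l₂) = stretch z l₁ ++ stretch (z + l₁.length) l₂ := by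
  induction l₁ with
  | nil => simp [stretch]
  | cons s l ih =>
    intro z
    rw [List.cons_append, stretch, ih, stretch, List.cons_append]
    congr 3; simp; ring

theorem isChain_shrink (l : List ℤ) (h : l.IsChain fun y y' => y + 2 ≤ y') : ∀ z : ℤ,
    (shrink z l).IsChain (· ≤ ·) := by
  induction l with
  | nil => intro; exact List.isChain_nil
  | cons y l ih =>
    intro z
    cases l with
    | nil => exact List.isChain_singleton _
    | cons y' l =>
      have h1 := (List.isChain_cons_cons.mp h).1
      exact List.isChain_cons_cons.mpr ⟨by omega, ih h.tail (z + 2)⟩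

theorem length_sw (l : List (ℕ × ℕ)) : ∀ p, (sw p l).length = 2 * l.length := by
  induction l with
  | nil => intro; rfl
  | cons b l ih => intro p; simp [sw, ih]; ring

theorem foldr_ins_append {l : List ℤ} {F : List ℤ} (hF : F.Pairwise (· ≤ ·))
    (h : ∀ f ∈ F, ∀ t ∈ l, t < f) : F.foldr ins l = l ++ F.flatMap fun f => [f, f] := by
  have h1 : ∀ (p : ℤ) (l r : List ℤ), (∀ t ∈ l, t < p) → ins p (l ++ r) = l ++ ins p r := by
    intro p l r hl
    induction l with
    | nil => rfl
    | cons s l ih =>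
      simp [ins, hl s (by simp), ih fun t ht => hl t (by simp [ht])]
  induction F with
  | nil => simp
  | cons f F ih =>
    rw [List.pairwise_cons] at hF
    rw [List.foldr_cons, ih hF.2 fun g hg => h g (by simp [hg]), h1 _ _ _ (h f (by simp)),
      ins_of_le]
    · rfl
    · intro t ht
      obtain ⟨g, hg, ht⟩ := List.mem_flatMap.mp ht
      have := hF.1 g hg
      simp at ht; omega

theorem lt_of_mem_sw (l : List (ℕ × ℕ)) (hl : ∀ b ∈ l, 1 ≤ b.2) : ∀ p : ℤ, ∀ t ∈ sw p l,
    t < p + blocksLength l := by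
  induction l with
  | nil => simp [sw]
  | cons b l ih =>
    intro p t ht
    have h1 := hl b (by simp)
    have h2 : (blocksLength (b :: l) : ℤ) = b.1 + b.2 + blocksLength l := by
      simp [blocksLength]
    simp only [sw, List.mem_cons] at ht
    rcases ht with rfl | rfl | ht
    · omega
    · omega
    · have := ih (fun c hc => hl c (by simp [hc])) _ t ht; omega

/-- A slow soliton behind fast solitons, as change positions: its balls are shifted by two to the
left by each fast soliton, and the fast solitons run away. -/
theorem eventually_flow_sw_append {m : ℕ} {bl : List (ℕ × ℕ)}
    (hbl : ∀ b ∈ bl, 2 ≤ b.1 ∧ b.1 ≤ b.2) (p : ℤ) {ys : List ℤ}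
    (hys : ys.IsChain fun y y' => y + 2 ≤ y') (hy : ∀ y ∈ ys, p + blocksLength bl ≤ y) (C : ℤ) :
    ∃ N₀ : ℕ, ∀ N ≥ N₀, ∃ (p' : ℤ) (bl' : List (ℕ × ℕ)),
      (bl'.map Prod.fst).Perm (bl.map Prod.fst) ∧ (∀ b ∈ bl', 1 ≤ b.1 ∧ b.1 ≤ b.2) ∧
      C + N ≤ p' ∧ (∀ y ∈ ys, y + (N - 2 * bl.length) + 2 ≤ p') ∧
      (flow ((m : ℤ) + 2) 0)^[N] (sw p bl ++ ys.flatMap fun y => [y, y + 1]) =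
        ((ys.map (· + ((N : ℤ) - 2 * bl.length))).flatMap fun y => [y, y + 1]) ++ sw p' bl' := by
  obtain ⟨bl₁, hbl₁⟩ : ∃ bl₁, bl₁ = bl.map fun b => (b.1 - 1, b.2 - 1) := ⟨_, rfl⟩
  have hmap : bl₁.map (fun b => (b.1 + 1, b.2 + 1)) = bl := by
    rw [hbl₁]
    exact map_pred_succ fun b hb => by have := hbl b hb; omega
  have h1 : ∀ b ∈ bl₁, 1 ≤ b.1 ∧ b.1 ≤ b.2 := by
    rw [hbl₁]
    intro b hb
    obtain ⟨c, hc, rfl⟩ := List.mem_map.mp hb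
    have := hbl c hc
    simp only; omega
  have hlen : bl₁.length = bl.length := by simp [hbl₁]
  have hsum : blocksLength bl = blocksLength bl₁ + 2 * bl.length := by
    rw [← hmap]
    clear hmap hbl₁ h1 hlen
    induction bl₁ with
    | nil => rfl
    | cons b l ih => simp [blocksLength] at ih ⊢; omega
  -- Before the collision, two changes for each fast soliton precede the balls. Afterwards none does
  -- and the stretch starts at `N`, whence the displacement `N - 2 * bl.length`.
  obtain ⟨F, hF⟩ : ∃ F, F = shrink (2 * bl.length) ys := ⟨_, rfl⟩
  have hFs : F.Pairwise (· ≤ ·) := by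
    rw [hF]; exact List.isChain_iff_pairwise.mp (isChain_shrink ys hys _)
  have hFlo : ∀ f ∈ F, p + blocksLength bl₁ ≤ f := by
    intro f hf
    rw [hF] at hf hFs
    cases ys with
    | nil => simp [shrink] at hf
    | cons y l =>
      have := hy y (by simp)
      rw [shrink, List.pairwise_cons] at hFs
      rcases List.mem_cons.mp hf with rfl | hf
      · omega
      · have := hFs.1 f hf; omega
  have hL : sw p bl ++ (ys.flatMap fun y => [y, y + 1]) = stretch 0 (F.foldr ins (sw p bl₁)) := by
    rw [foldr_ins_append hFs, stretch_append, stretch_sw, hmap, length_sw, hF, hlen,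
      stretch_flatMap_shrink]
    · simp
    · intro f hf t ht
      have := hFlo f hf
      have := lt_of_mem_sw bl₁ (fun b hb => (h1 b hb).1.trans (h1 b hb).2) p t ht
      omega
  obtain ⟨C', hC'⟩ : ∃ C' : ℤ, C ≤ C' ∧ ∀ f ∈ F, f ≤ C' := by
    clear hF hFs hFlo hL
    induction F with
    | nil => exact ⟨C, by simp⟩
    | cons f F ihF =>
      obtain ⟨C', h⟩ := ihF
      refine ⟨max C' f, by omega, fun g hg => ?_⟩
      rcases List.mem_cons.mp hg with rfl | hg
      · omega
      · have := h.2 g hg; omega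
  obtain ⟨N₀, hN₀⟩ := eventually_sw m bl₁ h1 p C'
  refine ⟨N₀, fun N hN => ?_⟩
  obtain ⟨p', l', k1, k2, k3, k4⟩ := hN₀ N hN
  have hFl : ((F.flatMap fun f => [f, f]).length : ℤ) = 2 * ys.length := by
    have : F.length = ys.length := by rw [hF, length_shrink]
    rw [← this]
    clear hF hFs hFlo hL hC' this
    induction F with
    | nil => rfl
    | cons f F ih => simp at ih ⊢; omega
  refine ⟨p' + (N + 2 * ys.length), l'.map fun b => (b.1 + 1, b.2 + 1), ?_, ?_, ?_, ?_, ?_⟩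
  · have e : ∀ l : List (ℕ × ℕ), (l.map fun b => (b.1 + 1, b.2 + 1)).map Prod.fst =
        (l.map Prod.fst).map (· + 1) := fun l => by simp
    rw [← hmap, e, e]
    exact k1.map _
  · intro b hb
    obtain ⟨c, hc, rfl⟩ := List.mem_map.mp hb
    have := k2 c hc
    simp only; omega
  · omega
  -- The `i`-th ball, counted from zero, has been shifted by `z + 2 * i`, and `i + 1 ≤ ys.length`;
  -- this leaves the spare 2.
  · have hup : ∀ (ys : List ℤ) (z : ℤ), (∀ f ∈ shrink z ys, f ≤ C') →
        ∀ y ∈ ys, y + 2 ≤ C' + z + 2 * ys.length := by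
      intro ys
      induction ys with
      | nil => simp
      | cons y l ih =>
        intro z h y' hy'
        have h3 := h (y - z) (by simp [shrink])
        rcases List.mem_cons.mp hy' with rfl | hy'
        · simp; omega
        · have := ih (z + 2) (fun f hf => h f (by simp [shrink, hf])) y' hy'
          simp; omega
    intro y hy
    have := hup ys (2 * bl.length) (by rw [← hF]; exact hC'.2) y hy
    omega
  · have e : (m : ℤ) + 2 = (m : ℤ) + 1 + 1 := by ring
    rw [hL, e, iterate_flow_stretch, iterate_flow_foldr_ins (by omega) (pairwise_sw _ _), k4,
      foldr_ins_of_le hFs, stretch_append, hFl, stretch_sw, hF, stretch_flatMap_shrink, zero_add]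
    · intro f hf t ht
      have := le_of_mem_sw _ _ t ht
      have := hC'.2 f hf
      omega

/-! ### Reading off the final state -/

/-- Separate balls as blocks. -/
theorem exists_sw_eq_balls (ys : List ℤ) (hys : ys.IsChain fun y y' => y + 2 ≤ y') (P : ℤ)
    (hP : ∀ y ∈ ys, y + 2 ≤ P) : ∃ (p : ℤ) (G : List ℕ), G.length = ys.length ∧
      (∀ g ∈ G, 1 ≤ g) ∧ (ys.flatMap fun y => [y, y + 1]) = sw p (G.map fun g => (1, g)) ∧
      p + blocksLength (G.map fun g => (1, g)) = P ∧ (ys = [] ∨ ys.head? = some p) := by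
  induction ys with
  | nil => exact ⟨P, [], by simp [sw, blocksLength]⟩
  | cons y ys ih =>
    obtain ⟨p, G, h1, h2, h3, h4, h5⟩ := ih hys.tail fun z hz => hP z (by simp [hz])
    have hyp : y + 2 ≤ p := by
      rcases h5 with rfl | h5
      · have hG : G = [] := List.length_eq_zero_iff.mp (by simpa using h1)
        subst hG
        have := hP y (by simp)
        simp [blocksLength] at h4; omega
      · cases ys with
        | nil => simp at h5
        | cons z ys =>
          have := (List.isChain_cons_cons.mp hys).1
          simp at h5; omega
    refine ⟨y, (p - y - 1).toNat :: G, by simp [h1], ?_, ?_, ?_, by simp⟩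
    · intro g hg
      rcases List.mem_cons.mp hg with rfl | hg
      · omega
      · exact h2 g hg
    · have e : y + ((1 : ℕ) : ℤ) + ((p - y - 1).toNat : ℤ) = p := by omega
      simp only [List.flatMap_cons, h3, List.map_cons, sw, e]
      simp
    · simp [blocksLength] at h4 ⊢
      omega

theorem isDisjointUnion_place (p : ℤ) (X : List (Soliton × ℕ)) (h : ∀ x ∈ X, x.1.speed ≤ x.2) :
    IsDisjointUnion (place p (X.flatMap fun x => x.1.sites ++ List.replicate x.2 V))
      (X.map Prod.fst) := by
  refine ⟨p, X.map Prod.snd, ?_, ?_⟩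
  · rw [List.forall₂_map_left_iff, List.forall₂_map_right_iff, List.forall₂_same]
    exact h
  · congr 1
    rw [List.zipWith_map, List.zipWith_self, List.flatMap_def]

theorem pairwise_lt_sw (l : List (ℕ × ℕ)) (h : ∀ b ∈ l, 1 ≤ b.1 ∧ 1 ≤ b.2) : ∀ p : ℤ,
    (sw p l).Pairwise (· < ·) := by
  induction l with
  | nil => simp [sw]
  | cons b l ih =>
    intro p
    have hb := h b (by simp)
    simp only [sw, List.pairwise_cons, List.mem_cons]
    refine ⟨?_, fun t ht => ?_, ih (fun c hc => h c (by simp [hc])) _⟩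
    · rintro t (rfl | ht)
      · omega
      · have := le_of_mem_sw l _ t ht; omega
    · have := le_of_mem_sw l _ t ht; omega

theorem pairwise_lt_flatMap {ys : List ℤ} (h : ys.IsChain fun y y' => y + 2 ≤ y') :
    (ys.flatMap fun y => [y, y + 1]).Pairwise (· < ·) := by
  have : Trans (fun y y' : ℤ => y + 2 ≤ y') (fun y y' : ℤ => y + 2 ≤ y')
      (fun y y' : ℤ => y + 2 ≤ y') := ⟨fun h1 h2 => by omega⟩
  have h' := List.isChain_iff_pairwise.mp h
  clear h
  induction ys with
  | nil => simp
  | cons y ys ih =>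
    rw [List.pairwise_cons] at h'
    have hy : ∀ t ∈ ys.flatMap fun y => [y, y + 1], y + 2 ≤ t := fun t ht => by
      obtain ⟨z, hz, ht⟩ := List.mem_flatMap.mp ht
      have := h'.1 z hz
      simp at ht; omega
    simp only [List.flatMap_cons, List.cons_append, List.nil_append, List.pairwise_cons,
      List.mem_cons]
    refine ⟨?_, fun t ht => ?_, ih h'.2⟩
    · rintro t (rfl | ht)
      · omega
      · have := hy t ht; omega
    · have := hy t ht; omega

/-- A disjoint union of fast solitons and a slow soliton behind them. -/
theorem exists_blocks_of_isDisjointUnion {ks : List ℕ} {A : List Letter} {S : State}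
    (h : IsDisjointUnion S (ks.map Soliton.fast ++ [Soliton.slow A])) :
    ∃ (p : ℤ) (bl : List (ℕ × ℕ)) (g : ℕ), bl.map Prod.fst = ks ∧ (∀ b ∈ bl, b.1 ≤ b.2) ∧
      S = place p (bl.flatMap blockSites ++ (A.map Letter.site ++ List.replicate g V)) := by
  obtain ⟨p, gaps, hg, rfl⟩ := h
  suffices H : ∃ (bl : List (ℕ × ℕ)) (g : ℕ), bl.map Prod.fst = ks ∧ (∀ b ∈ bl, b.1 ≤ b.2) ∧
      (List.zipWith (fun A g => A.sites ++ List.replicate g V)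
        (ks.map Soliton.fast ++ [Soliton.slow A]) gaps).flatten =
        bl.flatMap blockSites ++ (A.map Letter.site ++ List.replicate g V) by
    obtain ⟨bl, g, h1, h2, h3⟩ := H
    exact ⟨p, bl, g, h1, h2, by rw [h3]⟩
  induction ks generalizing gaps with
  | nil =>
    cases hg with
    | @cons _ g _ _ h1 h2 =>
      cases h2
      exact ⟨[], g, rfl, by simp, by simp [Soliton.sites]⟩
  | cons k ks ih =>
    cases hg with
    | @cons _ g _ gaps h1 h2 =>
      obtain ⟨bl, g', e1, e2, e3⟩ := ih gaps h2
      refine ⟨(k, g) :: bl, g', by simp [e1], ?_, ?_⟩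
      · intro b hb
        rcases List.mem_cons.mp hb with rfl | hb
        · exact h1
        · exact e2 b hb
      · rw [List.map_cons, List.cons_append, List.zipWith_cons_cons, List.flatten_cons, e3]
        simp [blockSites, Soliton.sites]

theorem simpleSite_letter {x : Letter} (h : x.Proper) : SimpleSite x.site := by
  cases x <;> simp [SimpleSite, Letter.site]

theorem simpleSite_V : SimpleSite V := by simp [SimpleSite, V]

theorem simpleSite_blocks (bl : List (ℕ × ℕ)) : ∀ s ∈ bl.flatMap blockSites, SimpleSite s := by
  intro s hs
  obtain ⟨b, -, hs⟩ := List.mem_flatMap.mp hs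
  rcases List.mem_append.mp hs with hs | hs
  · rw [List.eq_of_mem_replicate hs]; exact simpleSite_letter (x := .F) trivial
  · rw [List.eq_of_mem_replicate hs]; exact simpleSite_V

/-- The state with the separate balls `ys`, then the baskets of a string of letters `B`, then the
fast solitons `bl`. -/
theorem exists_enc_decomposition {ys : List ℤ} (hys : ys.IsChain fun y y' => y + 2 ≤ y')
    {cs : List ℕ} {P p' : ℤ} {bl : List (ℕ × ℕ)} (hbl : ∀ b ∈ bl, 1 ≤ b.1 ∧ b.1 ≤ b.2)
    (hP : ∀ y ∈ ys, y + 2 ≤ P) (hcs : cs = [] → P = p')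
    (hp' : cs ≠ [] → P + ((cs.map (· + 1)).sum : ℕ) + 1 ≤ p') :
    ∃ (S : State) (pos : ℤ → ℤ) (m : ℤ),
      Enc S ((ys.flatMap fun y => [y, y + 1]) ++ sw p' bl) (runRanks (P - ys.length) cs) pos m ∧
      IsDisjointUnion S (List.replicate ys.length (.slow [.F]) ++ pureB cs ++
        (bl.map Prod.fst).map Soliton.fast) := by
  obtain ⟨p, G, h1, h2, h3, h4, -⟩ := exists_sw_eq_balls ys hys P hP
  -- `g` is the vacuum behind the string of letters `B`. Without such a string the gap behind the
  -- last ball already reaches `P = p'`, and `g = 0`.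
  obtain ⟨g, hg⟩ : ∃ g : ℕ, P + ((cs.map (· + 1)).sum : ℕ) + g = p' := by
    by_cases h : cs = []
    · exact ⟨0, by simp [h, hcs h]⟩
    · exact ⟨(p' - (P + ((cs.map (· + 1)).sum : ℕ))).toNat, by have := hp' h; omega⟩
  have hG : ∀ b ∈ G.map fun g => (1, g), 1 ≤ b.1 ∧ 1 ≤ b.2 := by
    intro b hb
    obtain ⟨g, hg, rfl⟩ := List.mem_map.mp hb
    exact ⟨le_rfl, h2 g hg⟩
  have hbl' : ∀ b ∈ bl, 1 ≤ b.1 ∧ 1 ≤ b.2 := fun b hb => ⟨(hbl b hb).1,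
    (hbl b hb).1.trans (hbl b hb).2⟩
  obtain ⟨l, hl⟩ : ∃ l, l = (G.map fun g => (1, g)).flatMap blockSites ++
    ((cs.map fun c => (Letter.B c).site) ++ (List.replicate g V ++ (bl.flatMap blockSites ++ []))) :=
    ⟨_, rfl⟩
  have hs : ∀ s ∈ l, SimpleSite s := by
    intro s hs
    simp only [hl, List.mem_append] at hs
    rcases hs with hs | hs | hs | hs | hs
    · exact simpleSite_blocks _ s hs
    · obtain ⟨c, -, rfl⟩ := List.mem_map.mp hs
      simp [SimpleSite, Letter.site]
    · rw [List.eq_of_mem_replicate hs]; exact simpleSite_V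
    · exact simpleSite_blocks _ s hs
    · simp at hs
  have hch : changes false p l = (ys.flatMap fun y => [y, y + 1]) ++ sw p' bl := by
    rw [hl, changes_blocks _ hG, changes_pureB, changes_replicate_V, changes_blocks _ hbl', h3, h4,
      hg]
    simp [changes]
  have hra : ranks false p l = runRanks (P - ys.length) cs := by
    rw [hl, ranks_blocks _ hG, ranks_pureB, ranks_replicate_V, ranks_blocks _ hbl', h4]
    simp [ranks, h1]
  have henc := enc_place p l hs
  rw [hch, hra] at henc
  refine ⟨_, _, _, henc, ?_⟩
  have key := isDisjointUnion_place p
    ((G.map fun g => (Soliton.slow [.F], g)) ++ (pureB cs).map (fun A => (A, g)) ++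
      bl.map fun b => (Soliton.fast b.1, b.2)) ?_
  · convert key using 1
    · congr 1
      rw [hl, List.append_nil, List.flatMap_append, List.flatMap_append, List.append_assoc]
      congr 1
      · simp [List.flatMap_map, blockSites, Soliton.sites]
      · cases cs with
        | nil =>
          have : g = 0 := by
            have := hcs rfl
            simp at hg; omega
          simp [this, pureB, List.flatMap_map, Soliton.sites]
          rfl
        | cons c cs =>
          simp [pureB, List.flatMap_map, Soliton.sites, Function.comp_def]
          rfl
    · simp [Function.comp_def, h1]
  · intro x hx
    simp only [List.mem_append, List.mem_map] at hx
    rcases hx with (⟨g', hg', rfl⟩ | ⟨A, hA, rfl⟩) | ⟨b, hb, rfl⟩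
    · exact h2 g' hg'
    · cases cs with
      | nil => simp [pureB] at hA
      | cons c cs =>
        have := hp' (by simp)
        simp [pureB] at hA
        subst hA
        simp only [Soliton.speed]; omega
    · exact (hbl b hb).2

/-- For infinite capacity, a carrier with more places than there are balls never fills up, so `m =
K.toNat` will do. -/
theorem fits_of_two_le {ℓ : ℕ∞} (h : 2 ≤ ℓ) {L : List ℤ} {K : ℤ} (hK : AtMostOnes K L) :
    ∃ m : ℕ, Fits ℓ ((m : ℤ) + 2) ∧ (ℓ = ⊤ → AtMostOnes ((m : ℤ) + 2 - 1) L) := by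
  induction ℓ using ENat.recTopCoe with
  | top =>
    refine ⟨K.toNat, Or.inl rfl, fun _ => ?_⟩
    obtain ⟨W, h1, h2, h3⟩ := hK
    exact ⟨W, h1, h2, fun z => by have := h3 z; omega⟩
  | coe n =>
    have hn : 2 ≤ n := by exact_mod_cast h
    exact ⟨n - 2, Or.inr ⟨n, rfl, by omega⟩, fun h => absurd h (ENat.natCast_ne_top n)⟩

end BoxBasketBall

/-! ### The theorem -/

open BoxBasketBall
theorem mainTheorem5 (A : List Letter) (hA : IsSlowSoliton A) :
    (∃! cs : List Chunk, IsCutting cs A) ∧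
    ∀ cs : List Chunk, IsCutting cs A →
      ∃ M₀ : ℕ, ∀ ℓ : ℕ∞, 2 ≤ ℓ →
        ∀ ks : List ℕ, (∀ k ∈ ks, 2 ≤ k) → M₀ ≤ ks.length →
          ∀ S : State, IsDisjointUnion S (ks.map Soliton.fast ++ [Soliton.slow A]) →
            ∃ N₀ : ℕ, ∀ N : ℕ, N₀ ≤ N →
              ∃ ks' : List ℕ, ks'.Perm ks ∧
                IsDisjointUnion ((T ℓ)^[N] S) (decomposition cs ++ ks'.map Soliton.fast) := by
  obtain ⟨-, hproper, hchain⟩ := hA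
  refine ⟨⟨cutting A, isCutting_cutting hchain, fun cs h => eq_cutting h⟩, fun cs hcs => ?_⟩
  obtain rfl := eq_cutting hcs
  -- The balls fall back by twice the number of fast solitons, the baskets by this number and by `δ
  -- ≤ 1`. To have each ball at least two letters before the string of letters `B`, the difference
  -- must make up for the width of `A`, these two letters and `δ`.
  refine ⟨width A + 3, fun ℓ hℓ ks hks hM S hS => ?_⟩
  obtain ⟨p, bl, g, hfst, hgap, rfl⟩ := exists_blocks_of_isDisjointUnion hS
  have hlen : bl.length = ks.length := by rw [← hfst, List.length_map]
  have hbl : ∀ b ∈ bl, 2 ≤ b.1 ∧ b.1 ≤ b.2 := fun b hb =>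
    ⟨hks _ (hfst ▸ List.mem_map_of_mem hb), hgap b hb⟩
  have hbl1 : ∀ b ∈ bl, 1 ≤ b.1 ∧ 1 ≤ b.2 := fun b hb => by have := hbl b hb; omega
  obtain ⟨ys, hys⟩ : ∃ ys, ys = balls (p + blocksLength bl) A := ⟨_, rfl⟩
  have hbounds := balls_bounds A (p + blocksLength bl)
  rw [← hys] at hbounds
  have hysc : ys.IsChain fun y y' => y + 2 ≤ y' := hys ▸ isChain_balls A _ hproper hchain
  obtain ⟨δ, hδ0, hδ1, hδ⟩ := exists_runRanks_eq hchain
  obtain ⟨sub, hsub⟩ : ∃ sub, sub = (cutting A).flatMap Chunk.subscripts := ⟨_, rfl⟩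
  -- the initial state as a word with baskets
  have henc := enc_place p (bl.flatMap blockSites ++ (A.map Letter.site ++ List.replicate g V)) (by
    intro s hs
    simp only [List.mem_append] at hs
    rcases hs with hs | hs | hs
    · exact simpleSite_blocks _ s hs
    · obtain ⟨x, hx, rfl⟩ := List.mem_map.mp hs
      exact simpleSite_letter (hproper x hx)
    · rw [List.eq_of_mem_replicate hs]; exact simpleSite_V)
  rw [changes_blocks _ hbl1, changes_letters g A _ _ hproper hchain (by simp),
    ranks_blocks _ hbl1, ranks_letters g A _ _ hproper hchain (by simp), hδ, ← hys, ← hsub] at henc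
  simp only [Bool.false_eq_true, if_false, List.nil_append] at henc
  obtain ⟨L, hL⟩ : ∃ L, L = sw p bl ++ ys.flatMap fun y => [y, y + 1] := ⟨_, rfl⟩
  rw [← hL] at henc
  have hLs : L.Pairwise (· < ·) := by
    rw [hL, List.pairwise_append]
    refine ⟨pairwise_lt_sw _ hbl1 _, pairwise_lt_flatMap hysc, fun t ht t' ht' => ?_⟩
    obtain ⟨z, hz, ht'⟩ := List.mem_flatMap.mp ht'
    have h1 := hbounds z hz
    have h2 := lt_of_mem_sw bl (fun b hb => (hbl1 b hb).2) p t ht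
    simp at ht'; omega
  obtain ⟨K, hK⟩ := exists_atMostOnes (hLs.imp le_of_lt) (by
    rw [hL, List.length_append, length_sw, List.length_flatMap]
    simp)
  obtain ⟨m, hfits, htop⟩ := fits_of_two_le hℓ hK
  obtain ⟨N₀, hN₀⟩ := eventually_flow_sw_append (m := m) hbl p hysc (fun y hy => (hbounds y hy).1)
    (p + blocksLength bl + ys.length + ((sub.map (· + 1)).sum : ℕ) + 1)
  refine ⟨N₀, fun N hN => ?_⟩
  obtain ⟨p', bl', hperm, hbl', hp1, hp2, hflow⟩ := hN₀ N hN
  obtain ⟨⟨pos, hencN⟩, hthin⟩ := henc.iterate hfits (by omega) (thin_of_pairwise hLs)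
    (hLs.imp le_of_lt) htop N
  rw [hL, hflow, image_add_runRanks] at hencN
  rw [hL, hflow] at hthin
  refine ⟨bl'.map Prod.fst, hfst ▸ hperm, ?_⟩
  -- `P` is where the string of letters `B` begins. In the final word only the `ys.length` isolated
  -- balls precede it, so its position is the evolved rank plus `ys.length`.
  obtain ⟨P, hP1, hP2⟩ : ∃ P : ℤ, (sub = [] → P = p') ∧
      (sub ≠ [] → P = p + blocksLength bl - bl.length - δ + N + ys.length) := by
    by_cases h : sub = []
    · exact ⟨p', fun _ => rfl, fun h' => absurd h h'⟩
    · exact ⟨_, fun h' => absurd h' h, fun _ => rfl⟩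
  obtain ⟨S', pos', m', h1, h2⟩ := exists_enc_decomposition
    (ys := ys.map (· + ((N : ℤ) - 2 * bl.length))) (cs := sub) (P := P) (p' := p') (bl := bl')
    (by
      rw [List.isChain_map]
      exact hysc.imp fun a b h => by omega)
    hbl' (by
      intro y hy
      obtain ⟨z, hz, rfl⟩ := List.mem_map.mp hy
      by_cases h : sub = []
      · rw [hP1 h]; exact hp2 z hz
      · rw [hP2 h]
        have := hbounds z hz
        omega) hP1 (by
      intro h
      rw [hP2 h]; omega)
  have hrank : runRanks (P - (ys.map (· + ((N : ℤ) - 2 * bl.length))).length) sub =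
      runRanks (p + blocksLength bl - bl.length - δ + N) sub := by
    by_cases h : sub = []
    · simp [h, runRanks]
    · rw [hP2 h, List.length_map, add_sub_cancel_right]
  rw [hrank] at h1
  rw [hencN.unique hthin h1, decomposition, ← length_balls_eq A (p + blocksLength bl), ← hys, ← hsub]
  rwa [List.length_map] at h2
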